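/- Let $k\ge 1$. The Aztec diamond $A_k$ is the following plane bipartite graph with open faces. Its vertices are the points $(i,j)\in\{0,\dots,2k\}^2$ with $i+j$ odd, white if $i$ is even and black if $i$ is odd; two vertices are joined by an edge iff they differ by $(\pm1,\pm1)$. Its faces are indexed by the set $F$ of points $(i,j)\in\{0,\dots,2k\}^2$ with $i+j$ even, each edge separating the two faces at the two other corners of the unit square of which it is a diagonal; the face $(i,j)$ is internal if $i,j$ are odd or if $0<i,j<2k$, and open otherwise. The faces carry weights $a=(a_{i,j})$ in $\hat{\mathbb C}=\mathbb C\cup\{\infty\}$, and we write $c_{i,j}=a_{2i,2j}$ for $0\le i,j\le k$ and $d_{i,j}=a_{2i+1,2j+1}$ for $0\le i,j\le k-1$. A Kasteleyn orientation is a skew-symmetric function $\varphi$ on directed edges with values in $\{\pm1\}$ such that $\prod_{wb\in\partial f}\varphi_{(w,b)}=(-1)^{\deg(f)/2+1}$ for every internal face $f$, where $w$ is the white and $b$ the black endpoint. An oriented dimer configuration is a set of directed edges such that every vertex is an endpoint of exactly one of them. With $f(\vec e)$ the face to the right of $\vec e$, put $$Z(A_k,a,\varphi)=\sum_{\vec M}\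 \prod_{\vec e\in\vec M}\varphi_{\vec e}\,a_{f(\vec e)},\qquad Y(A_k,a)=\Big(\prod_{f\in F}a_f\Big)\frac{Z(A_k,a^{-1},\varphi)}{Z(A_k,a,\varphi)} .$$ As polynomials in independent weights, $Z(A_k,a,\varphi)$ and $\big(\prod_f a_f\big)Z(A_k,a^{-1},\varphi)$ have degree at most one in each $a_f$; weights equal to $0$ or $\infty$ are allowed, by homogenizing both polynomials to degree one in homogeneous coordinates of each $a_f$. $Y(A_k,a)\in\hat{\mathbb C}$ is well defined when numerator and denominator are not both $0$; it does not depend on the Kasteleyn orientation $\varphi$. **Theorem.** Let $m\ge2$, $p\ge1$ and $k=mp-2p+1$. Suppose that the weights are given for all vertical indices $j\in\mathbb Z$ and satisfy $$c_{i,j}=c_{i,j+m}\quad(0\le i\le k),\qquad d_{i,j}=d_{i,j+m}\quad(0\le i\le k-1),$$ and that there are constants $d_0,d_1,\dots$ such that $d_{i,j}=d_{i/p}$ for all $j$ whenever $0\le i\le k-1$ and $p\mid i$. Let $\tilde a_{i,j}=a_{i,[j+2]_{2m}}$, where $[n]_{2m}\in\{0,\dots,2m-1\}$ is the residue of $n$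 modulo $2m$. If $Y(A_k,a)$ and $Y(A_k,\tilde a)$ are both well defined in $\hat{\mathbb C}$, then $$Y(A_k,a)=Y(A_k,\tilde a).$$ -/

import Mathlib

open scoped OnePoint

namespace Aztec

/-!
The Aztec diamond graph of size `k`, drawn rotated by 45 degrees.  All objects live on the grid
`{0, …, 2k} × {0, …, 2k}`:
* the faces (internal or open) are the points with even coordinate sum: the "even" faces `(2i, 2j)`
  for `0 ≤ i, j ≤ k` and the "odd" faces `(2i+1, 2j+1)` for `0 ≤ i, j ≤ k-1`;
* the vertices are the points with odd coordinate sum: the white vertices `(2i, 2j+1)` and the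
  black vertices `(2i+1, 2j)`;
* a white and a black vertex are joined when they are diagonal neighbours `(±1, ±1)`.
-/

/-- The white vertex `(i, j)` sits at the point `(2i, 2j+1)`. -/
abbrev White (k : ℕ) := Fin (k + 1) × Fin k

/-- The black vertex `(i, j)` sits at the point `(2i+1, 2j)`. -/
abbrev Black (k : ℕ) := Fin k × Fin (k + 1)

/-- The faces: `inl (i, j)` sits at `(2i, 2j)`, and `inr (i, j)` sits at `(2i+1, 2j+1)`. -/
abbrev Face (k : ℕ) := (Fin (k + 1) × Fin (k + 1)) ⊕ (Fin k × Fin k)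

/-- The horizontal coordinates `2 * w.1` and `2 * b.1 + 1`, and the vertical coordinates
`2 * w.2 + 1` and `2 * b.2`, both differ by one. -/
def IsEdge {k : ℕ} (w : White k) (b : Black k) : Prop :=
  ((w.1 : ℕ) = b.1 ∨ (w.1 : ℕ) = b.1 + 1) ∧ ((b.2 : ℕ) = w.2 ∨ (b.2 : ℕ) = w.2 + 1)

/-- The even face adjacent to the edge `w b`. -/
def evenFace {k : ℕ} (w : White k) (b : Black k) : Face k := Sum.inl (w.1, b.2)

/-- The odd face adjacent to the edge `w b`. -/
def oddFace {k : ℕ} (w : White k) (b : Black k) : Face k := Sum.inr (b.1, w.2)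

open Classical in
/-- The edges of the graph adjacent to the face `f`. -/
noncomputable def boundary {k : ℕ} (f : Face k) : Finset (White k × Black k) :=
  Finset.univ.filter fun e => IsEdge e.1 e.2 ∧ (f = evenFace e.1 e.2 ∨ f = oddFace e.1 e.2)

/-- The internal faces: all odd faces, and the even faces that are not on the boundary of the
grid.  The other faces are open. -/
def IsInternal {k : ℕ} : Face k → Prop
  | Sum.inl (i, j) => 0 < (i : ℕ) ∧ (i : ℕ) < k ∧ 0 < (j : ℕ) ∧ (j : ℕ) < k
  | Sum.inr _ => True

/-- A Kasteleyn orientation.  `φ w b` is the sign of the edge directed from `w` to `b`; the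
oppositely directed edge has sign `-φ w b`.  Values at pairs that are not edges play no role. -/
def IsKasteleyn {k : ℕ} (φ : White k → Black k → ℤˣ) : Prop :=
  ∀ f : Face k, IsInternal f →
    ∏ e ∈ boundary f, φ e.1 e.2 = (-1) ^ ((boundary f).card / 2 + 1)

/-- A directed edge: `(w, b, true)` goes from `w` to `b`, and `(w, b, false)` from `b` to `w`. -/
abbrev DirEdge (k : ℕ) := White k × Black k × Bool

/-- The sign of a directed edge (skew-symmetric under reversal). -/
def dirSign {k : ℕ} (φ : White k → Black k → ℤˣ) : DirEdge k → ℤˣ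
  | (w, b, true) => φ w b
  | (w, b, false) => -φ w b

open Classical in
/-- The face on the right of a directed edge.  The edge from `w` to `b` heads east iff
`b.1 = w.1` and heads north iff `b.2 = w.2 + 1`.  If it heads north-east or south-west, then the
odd face is on its right; otherwise the even face is. -/
noncomputable def rightFace {k : ℕ} : DirEdge k → Face k
  | (w, b, true) =>
      if ((b.1 : ℕ) = w.1 ↔ (b.2 : ℕ) = w.2 + 1) then oddFace w b else evenFace w b
  | (w, b, false) =>
      if ((b.1 : ℕ) = w.1 ↔ (b.2 : ℕ) = w.2 + 1) then evenFace w b else oddFace w b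

/-- An oriented dimer configuration: a set of directed edges such that every vertex is an endpoint
of exactly one of them. -/
def IsOrientedDimer {k : ℕ} (M : Finset (DirEdge k)) : Prop :=
  (∀ e ∈ M, IsEdge e.1 e.2.1) ∧
    (∀ w : White k, ∃! e, e ∈ M ∧ e.1 = w) ∧ (∀ b : Black k, ∃! e, e ∈ M ∧ e.2.1 = b)

open Classical in
/-- The partition function of oriented dimers with face weights `x` in a commutative ring. -/
noncomputable def Z (k : ℕ) {R : Type*} [CommRing R] (x : Face k → R)
    (φ : White k → Black k → ℤˣ) : R :=
  ∑ M ∈ Finset.univ.filter (fun M : Finset (DirEdge k) => IsOrientedDimer M),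
    ∏ e ∈ M, (((dirSign φ e : ℤˣ) : ℤ) : R) * x (rightFace e)

/-- The partition function as a polynomial in independent face weights. -/
noncomputable def Zpoly (k : ℕ) (φ : White k → Black k → ℤˣ) : MvPolynomial (Face k) ℂ :=
  Z k MvPolynomial.X φ

/-- For a polynomial `P` with degree at most one in each variable, the value of its
multi-homogenization at the points with homogeneous coordinates `[x f : y f]`, that is
`(∏ f, y f) * P (x / y)` with denominators cleared. -/
noncomputable def homEval {σ : Type*} [Fintype σ] (P : MvPolynomial σ ℂ) (x y : σ → ℂ) : ℂ :=
  ∑ s ∈ P.support, P.coeff s * ∏ f, (x f ^ (s f : ℤ) * y f ^ (1 - (s f : ℤ)))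

/-- Homogeneous coordinates `[coordX z : coordY z]` of a point `z` of the Riemann sphere:
`[z : 1]` if `z` is finite and `[1 : 0]` if `z = ∞`. -/
noncomputable def coordX : OnePoint ℂ → ℂ := fun z => z.elim 1 id

/-- See `coordX`. -/
noncomputable def coordY : OnePoint ℂ → ℂ := fun z => z.elim 0 (fun _ => 1)

/-- The numerator `(∏ f, a f) * Z (a⁻¹)` of the ratio function (in homogeneous coordinates). -/
noncomputable def numY (k : ℕ) (φ : White k → Black k → ℤˣ) (a : Face k → OnePoint ℂ) : ℂ :=
  homEval (Zpoly k φ) (fun f => coordY (a f)) (fun f => coordX (a f))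

/-- The denominator `Z a` of the ratio function (in homogeneous coordinates). -/
noncomputable def denY (k : ℕ) (φ : White k → Black k → ℤˣ) (a : Face k → OnePoint ℂ) : ℂ :=
  homEval (Zpoly k φ) (fun f => coordX (a f)) (fun f => coordY (a f))

/-- The ratio function is well defined on the Riemann sphere when it is not of the form `0 / 0`. -/
def YDefined (k : ℕ) (φ : White k → Black k → ℤˣ) (a : Face k → OnePoint ℂ) : Prop :=
  ¬ (numY k φ a = 0 ∧ denY k φ a = 0)

open Classical in
/-- The ratio function of oriented dimers `Y (A_k, a) = (∏ f, a f) * Z (a⁻¹) / Z a`, as a point of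
the Riemann sphere. -/
noncomputable def Y (k : ℕ) (φ : White k → Black k → ℤˣ) (a : Face k → OnePoint ℂ) : OnePoint ℂ :=
  if denY k φ a = 0 then ∞ else ((numY k φ a / denY k φ a : ℂ) : OnePoint ℂ)

/-- For finite weights the denominator is the partition function itself. -/
theorem denY_coe (k : ℕ) (φ : White k → Black k → ℤˣ) (z : Face k → ℂ) :
    denY k φ (fun f => (z f : OnePoint ℂ)) = Z k z φ := by
  have h : Z k z φ = MvPolynomial.eval z (Zpoly k φ) := by
    simp [Z, Zpoly, map_sum, map_prod]
  rw [h, MvPolynomial.eval_eq']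
  simp [denY, homEval, coordX, coordY]

/-- For finite nonzero weights the numerator is literally `(∏ f, a f) * Z (a⁻¹)`. -/
theorem numY_coe (k : ℕ) (φ : White k → Black k → ℤˣ) (z : Face k → ℂ) (hz : ∀ f, z f ≠ 0) :
    numY k φ (fun f => (z f : OnePoint ℂ)) = (∏ f, z f) * Z k (fun f => (z f)⁻¹) φ := by
  have h : Z k (fun f => (z f)⁻¹) φ = MvPolynomial.eval (fun f => (z f)⁻¹) (Zpoly k φ) := by
    simp [Z, Zpoly, map_sum, map_prod]
  rw [h, MvPolynomial.eval_eq', Finset.mul_sum]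
  refine Finset.sum_congr rfl fun s _ => ?_
  rw [mul_left_comm, ← Finset.prod_mul_distrib]
  congr 1
  refine Finset.prod_congr rfl fun f _ => ?_
  simp [coordX, coordY, zpow_sub₀ (hz f), div_eq_mul_inv]

/-- The face weights of `A_k` read off from a family `a i j` indexed by the points of the grid
(only the entries with `i + j` even are used). -/
def faceWeight (k : ℕ) (a : ℤ → ℤ → OnePoint ℂ) : Face k → OnePoint ℂ
  | Sum.inl (i, j) => a (2 * (i : ℕ)) (2 * (j : ℕ))
  | Sum.inr (i, j) => a (2 * (i : ℕ) + 1) (2 * (j : ℕ) + 1)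

/-- With `c i j = a (2i) (2j)` for `0 ≤ i ≤ k` and `d i j = a (2i+1) (2j+1)` for `0 ≤ i ≤ k-1`:
both families are `(0, m)`-periodic, and the column `d i` is constant whenever `p` divides `i`. -/
def PeriodicWeights (m p k : ℕ) (a : ℤ → ℤ → OnePoint ℂ) : Prop :=
  (∀ i j : ℤ, 0 ≤ i → i ≤ k → a (2 * i) (2 * j) = a (2 * i) (2 * (j + m))) ∧
  (∀ i j : ℤ, 0 ≤ i → i < k → a (2 * i + 1) (2 * j + 1) = a (2 * i + 1) (2 * (j + m) + 1)) ∧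
  (∃ δ : ℤ → OnePoint ℂ, ∀ i j : ℤ, 0 ≤ i → i < k → (p : ℤ) ∣ i →
    a (2 * i + 1) (2 * j + 1) = δ (i / p))

/-- The weights translated vertically by two units, indices being taken modulo `2m`. -/
def shiftWeights (m : ℕ) (a : ℤ → ℤ → OnePoint ℂ) : ℤ → ℤ → OnePoint ℂ :=
  fun i j => a i ((j + 2) % (2 * (m : ℤ)))

end Aztec

/-! The numerator and the denominator of `Y` are, up to a common factor and a sign, determinants of
two matrices that differ in a single row. With Kasteleyn signs, `Z` is up to sign the determinant of
a white-by-black matrix whose entry at an edge is, up to sign, the difference of the two adjacent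
face weights (`IsKasteleyn.Z_eq_det`). Enlarge it to a square matrix with a column for each face
`f`, of weight `[x f : y f]`: each white vertex gives two rows, its signed incidences with the faces
weighted by `x` and by `y`, and one last row lives on the bottom even faces
(`exists_det_edgeMatrix`). The last row is weighted by `y` in the denominator and, once the two
blocks of white rows are exchanged, by `x` in the numerator. So any nonzero `u` annihilated by the
white rows computes `Y`, up to a fixed sign, as the quotient of the sums of `x f * u f` and `y f * u
f` over the bottom row (`Y_eq_of_kernel`).

The white equations are local, so for periodic weights they make sense on a cylinder of
circumference `m`. A solution there restricts to every window of the cylinder, and adding the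
equations along a row of white vertices shows that the two sums do not depend on the height
(`sum_row_eq`). The windows at heights `0` and `1` belong to `a` and to the shifted weights, whence
the theorem.

It remains to find a nonzero periodic solution (`exists_periodic_kernel`). There are `k m + (k + 1)
m` unknowns and `2 (k + 1) m` equations, a deficit of `m`. One source is allowed for each of the `m
- 1` constant columns, and two further ones at the last column: with `m + 1` more unknowns a nonzero
solution of the perturbed system exists. Summing around the cylinder forces all sources to vanish,
which is where constancy of the columns is used. -/

namespace Aztec

/-! ### Signs of matchings by counting inversions -/

section Kasteleyn

variable {k : ℕ}

/-- The white vertices, enumerated lexicographically. -/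
def whiteIdx (k : ℕ) : White k ≃ Fin ((k + 1) * k) := finProdFinEquiv

/-- The black vertices, enumerated lexicographically. -/
def blackIdx (k : ℕ) : Black k ≃ Fin ((k + 1) * k) :=
  finProdFinEquiv.trans (finCongr (mul_comm _ _))

theorem finProdFinEquiv_lt_iff {a b : ℕ} (x y : Fin a × Fin b) :
    (finProdFinEquiv x : ℕ) < finProdFinEquiv y ↔
      (x.1 : ℕ) < y.1 ∨ (x.1 : ℕ) = y.1 ∧ (x.2 : ℕ) < y.2 := by
  obtain ⟨⟨i, hi⟩, ⟨j, hj⟩⟩ := x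
  obtain ⟨⟨i', hi'⟩, ⟨j', hj'⟩⟩ := y
  simp only [finProdFinEquiv_apply_val]
  constructor
  · intro h
    rcases lt_trichotomy i i' with h1 | h1 | h1
    · exact Or.inl h1
    · subst h1; right; exact ⟨rfl, by omega⟩
    · exfalso
      have := Nat.mul_le_mul_left b (show i' + 1 ≤ i from h1)
      rw [mul_add] at this
      omega
  · rintro (h | ⟨h, h'⟩)
    · have := Nat.mul_le_mul_left b (show i + 1 ≤ i' from h)
      rw [mul_add] at this
      omega
    · subst h; omega

theorem whiteIdx_lt_iff (x y : White k) : whiteIdx k x < whiteIdx k y ↔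
    (x.1 : ℕ) < y.1 ∨ (x.1 : ℕ) = y.1 ∧ (x.2 : ℕ) < y.2 :=
  finProdFinEquiv_lt_iff x y

theorem blackIdx_lt_iff (x y : Black k) : blackIdx k x < blackIdx k y ↔
    (x.1 : ℕ) < y.1 ∨ (x.1 : ℕ) = y.1 ∧ (x.2 : ℕ) < y.2 :=
  finProdFinEquiv_lt_iff x y

/-- The number of inversions of a matching whose first entry `w` is matched to the east. -/
theorem card_inversions_east (τ : White k ≃ Black k) (h : ∀ w, IsEdge w (τ w)) (w : White k)
    (hw : (w.1 : ℕ) = (τ w).1) :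
    (∑ w', if whiteIdx k w < whiteIdx k w' ∧ blackIdx k (τ w') < blackIdx k (τ w) then 1 else 0)
      + (∑ w' : White k, if w'.1 = w.1 ∧ (w'.1 : ℕ) = (τ w').1 then 1 else 0) =
    k + if ((τ w).2 : ℕ) = w.2 + 1 then 1 else 0 := by
  have h1 : (∑ w' : White k, if w'.1 = w.1 ∧ w.2 < w'.2 then 1 else 0) = k - 1 - w.2 := by
    rw [Fintype.sum_prod_type, Finset.sum_eq_single w.1]
    · simp [Finset.filter_lt_eq_Ioi]
    · intro i _ hi; simp [hi]
    · simp
  have h2 : (∑ w' : White k, if (τ w').1 = (τ w).1 ∧ (τ w').2 < (τ w).2 then 1 else 0)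
      = ((τ w).2 : ℕ) := by
    rw [Equiv.sum_comp τ (fun b : Black k => if b.1 = (τ w).1 ∧ b.2 < (τ w).2 then 1 else 0),
      Fintype.sum_prod_type, Finset.sum_eq_single (τ w).1]
    · simp [Finset.filter_gt_eq_Iio]
    · intro i _ hi; simp [hi]
    · simp
  have h3 : (∑ w' : White k, if w' = w then 1 else 0) = 1 := by simp
  -- Later whites in the column of `w`, and whites matched below `τ w` in its column, account for
  -- all inversions; the correction counts the east-matched whites in the column of `w`.
  have key : ∀ w' : White k,
      (if whiteIdx k w < whiteIdx k w' ∧ blackIdx k (τ w') < blackIdx k (τ w) then 1 else 0)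
        + (if w'.1 = w.1 ∧ (w'.1 : ℕ) = (τ w').1 then 1 else 0) =
      (if w'.1 = w.1 ∧ w.2 < w'.2 then 1 else 0)
        + (if (τ w').1 = (τ w).1 ∧ (τ w').2 < (τ w).2 then 1 else 0)
        + (if w' = w then 1 else 0) := by
    intro w'
    obtain ⟨e1, e2⟩ := h w
    obtain ⟨e3, e4⟩ := h w'
    by_cases hww : w' = w
    · subst hww
      simp [hw]
    · have n1 : ¬ ((w'.1 : ℕ) = w.1 ∧ (w'.2 : ℕ) = w.2) := by
        rintro ⟨p, q⟩; exact hww (Prod.ext (Fin.ext p) (Fin.ext q))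
      have n2 : ¬ (((τ w').1 : ℕ) = (τ w).1 ∧ ((τ w').2 : ℕ) = (τ w).2) := by
        rintro ⟨p, q⟩; exact hww (τ.injective (Prod.ext (Fin.ext p) (Fin.ext q)))
      rw [if_neg hww]
      simp only [whiteIdx_lt_iff, blackIdx_lt_iff]
      simp only [Fin.ext_iff, Fin.lt_def]
      split_ifs <;> omega
  rw [← Finset.sum_add_distrib, Finset.sum_congr rfl fun w' _ => key w', Finset.sum_add_distrib,
    Finset.sum_add_distrib, h1, h2, h3]
  have := w.2.isLt
  obtain ⟨e1, e2⟩ := h w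
  split_ifs <;> omega

/-- A west edge ends in the column just before that of `w`, and no later white vertex can be matched
below its endpoint or in an earlier column. -/
theorem card_inversions_west (τ : White k ≃ Black k) (h : ∀ w, IsEdge w (τ w)) (w : White k)
    (hw : (w.1 : ℕ) ≠ (τ w).1) :
    (∑ w', if whiteIdx k w < whiteIdx k w' ∧ blackIdx k (τ w') < blackIdx k (τ w) then 1 else 0)
      = 0 := by
  refine Finset.sum_eq_zero fun w' _ => if_neg ?_
  obtain ⟨e1, e2⟩ := h w
  obtain ⟨e3, e4⟩ := h w'
  have n2 : w' ≠ w → ¬ (((τ w').1 : ℕ) = (τ w).1 ∧ ((τ w').2 : ℕ) = (τ w).2) := by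
    rintro hww ⟨p, q⟩; exact hww (τ.injective (Prod.ext (Fin.ext p) (Fin.ext q)))
  by_cases hww : w' = w
  · subst hww; simp
  · have := n2 hww
    simp only [whiteIdx_lt_iff, blackIdx_lt_iff]
    omega

/-- The number of edges of a matching that head north-east. -/
def northEast (τ : White k ≃ Black k) : ℕ :=
  ∑ w, if (w.1 : ℕ) = (τ w).1 ∧ ((τ w).2 : ℕ) = w.2 + 1 then 1 else 0

/-- The number of edges of a matching that head east. -/
def east (τ : White k ≃ Black k) : ℕ := ∑ w, if (w.1 : ℕ) = (τ w).1 then 1 else 0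

/-- Comparing total horizontal coordinates of both colours shows that all matchings have the same
number of east edges. -/
theorem east_add (τ : White k ≃ Black k) (h : ∀ w, IsEdge w (τ w)) :
    east τ + ∑ w : White k, (w.1 : ℕ) = Fintype.card (White k) + ∑ b : Black k, (b.1 : ℕ) := by
  rw [← Equiv.sum_comp τ, east, ← Finset.card_univ, Finset.card_eq_sum_ones,
    ← Finset.sum_add_distrib, ← Finset.sum_add_distrib]
  refine Finset.sum_congr rfl fun w _ => ?_
  have := (h w).1
  split_ifs <;> omega

/-- If `r i` edges head east from column `i`, the corrections in `card_inversions_east` add up to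
the sum of the squares of the `r i`, which has the parity of their sum `east τ`. -/
theorem inversions_parity (τ : White k ≃ Black k) (h : ∀ w, IsEdge w (τ w)) :
    Even ((∑ w, ∑ w',
      if whiteIdx k w < whiteIdx k w' ∧ blackIdx k (τ w') < blackIdx k (τ w) then 1 else 0)
        + (k + 1) * east τ + northEast τ) := by
  set r : Fin (k + 1) → ℕ := fun i => ∑ j : Fin k, if (i : ℕ) = (τ (i, j)).1 then 1 else 0 with hr
  have hcol : ∀ w : White k,
      (∑ w' : White k, if w'.1 = w.1 ∧ (w'.1 : ℕ) = (τ w').1 then 1 else 0) = r w.1 := by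
    intro w
    rw [Fintype.sum_prod_type, Finset.sum_eq_single w.1]
    · simp [hr]
    · intro i _ hi; simp [hi]
    · simp
  have hE : east τ = ∑ i, r i := by rw [east, Fintype.sum_prod_type]
  have hsq : (∑ w : White k, (if (w.1 : ℕ) = (τ w).1 then 1 else 0) * r w.1) = ∑ i, r i * r i := by
    rw [Fintype.sum_prod_type]
    refine Finset.sum_congr rfl fun i _ => ?_
    dsimp only
    rw [← Finset.sum_mul]
  have hmain : (∑ w, ∑ w',
      if whiteIdx k w < whiteIdx k w' ∧ blackIdx k (τ w') < blackIdx k (τ w) then 1 else 0)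
        + ∑ i, r i * r i = k * east τ + northEast τ := by
    rw [← hsq, east, northEast, Finset.mul_sum, ← Finset.sum_add_distrib,
      ← Finset.sum_add_distrib]
    refine Finset.sum_congr rfl fun w _ => ?_
    by_cases hw : (w.1 : ℕ) = (τ w).1
    · have := card_inversions_east τ h w hw
      rw [hcol] at this
      simp only [hw, true_and, if_true, one_mul, mul_one] at this ⊢
      exact this
    · rw [card_inversions_west τ h w hw]
      simp [hw]
  have hev : Even (∑ i, r i * r i + east τ) := by
    rw [hE, ← Finset.sum_add_distrib]
    refine Finset.even_sum _ fun i _ => ?_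
    rw [← Nat.mul_succ]
    exact Nat.even_mul_succ_self _
  have e1 : (k + 1) * east τ = k * east τ + east τ := by ring
  rw [Nat.even_iff] at hev ⊢
  omega

/-- The reference orientation. -/
def refSign (w : White k) (b : Black k) : ℤˣ :=
  if (w.1 : ℕ) = b.1 ∧ (b.2 : ℕ) = w.2 + 1 then -1 else 1

theorem prod_refSign (τ : White k ≃ Black k) :
    ∏ w, refSign w (τ w) = (-1) ^ northEast τ := by
  rw [northEast, ← Finset.prod_pow_eq_pow_sum]
  refine Finset.prod_congr rfl fun w _ => ?_
  unfold refSign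
  split_ifs <;> simp

/-- The permutation of the index set that represents a matching. -/
def matchPerm (τ : White k ≃ Black k) : Equiv.Perm (Fin ((k + 1) * k)) :=
  ((whiteIdx k).symm.trans τ).trans (blackIdx k)

theorem sign_matchPerm (τ : White k ≃ Black k) :
    Equiv.Perm.sign (matchPerm τ) = (-1) ^ (∑ w, ∑ w',
      if whiteIdx k w < whiteIdx k w' ∧ blackIdx k (τ w') < blackIdx k (τ w) then 1 else 0) := by
  rw [Equiv.Perm.sign_eq_prod_prod_Ioi, ← Equiv.prod_comp (whiteIdx k),
    ← Finset.prod_pow_eq_pow_sum]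
  refine Finset.prod_congr rfl fun w _ => ?_
  rw [← Finset.prod_pow_eq_pow_sum, ← Equiv.prod_comp (whiteIdx k).symm]
  rw [← Finset.prod_subset (Finset.subset_univ (Finset.Ioi (whiteIdx k w)))]
  · refine Finset.prod_congr rfl fun i hi => ?_
    rw [Finset.mem_Ioi] at hi
    have hne : blackIdx k (τ ((whiteIdx k).symm i)) ≠ blackIdx k (τ w) := by
      intro hc
      have := τ.injective ((blackIdx k).injective hc)
      rw [← this] at hi
      simp at hi
    simp only [matchPerm, Equiv.trans_apply, Equiv.symm_apply_apply, Equiv.apply_symm_apply, hi,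
      true_and]
    rcases lt_or_gt_of_ne hne with h | h
    · rw [if_neg (not_lt_of_gt h), if_pos h]; simp
    · rw [if_pos h, if_neg (not_lt_of_gt h)]; simp
  · intro i _ hi
    rw [Finset.mem_Ioi] at hi
    simp [hi]

/-- The reference orientation computes signs of matchings. -/
theorem sign_mul_prod_refSign (τ τ' : White k ≃ Black k) (h : ∀ w, IsEdge w (τ w))
    (h' : ∀ w, IsEdge w (τ' w)) :
    Equiv.Perm.sign (matchPerm τ) * ∏ w, refSign w (τ w) =
      Equiv.Perm.sign (matchPerm τ') * ∏ w, refSign w (τ' w) := by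
  have hE : east τ = east τ' := by
    have := east_add τ h
    have := east_add τ' h'
    omega
  have p1 := inversions_parity τ h
  have p2 := inversions_parity τ' h'
  rw [sign_matchPerm, sign_matchPerm, prod_refSign, prod_refSign, ← pow_add, ← pow_add]
  rw [hE] at p1
  rw [Nat.even_iff] at p1 p2
  rw [Int.units_pow_eq_pow_mod_two]
  conv_rhs => rw [Int.units_pow_eq_pow_mod_two]
  congr 1
  omega

end Kasteleyn

/-! ### Gauge equivalence of Kasteleyn orientations -/

section Gauge

variable {k : ℕ}

/-- Extension of a function on edges to all quadruples of coordinates. -/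
def extend (φ : White k → Black k → ℤˣ) (i j i' j' : ℕ) : ℤˣ :=
  if h : (i < k + 1 ∧ j < k) ∧ (i' < k ∧ j' < k + 1) then
    φ (⟨i, h.1.1⟩, ⟨j, h.1.2⟩) (⟨i', h.2.1⟩, ⟨j', h.2.2⟩) else 1

theorem extend_coe (φ : White k → Black k → ℤˣ) (w : White k) (b : Black k) :
    extend φ w.1 w.2 b.1 b.2 = φ w b := by
  exact dif_pos ⟨⟨w.1.isLt, w.2.isLt⟩, b.1.isLt, b.2.isLt⟩

open Classical in
theorem boundary_odd {i j : ℕ} (hi : i < k) (hj : j < k) :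
    boundary (Sum.inr (⟨i, hi⟩, ⟨j, hj⟩) : Face k) =
      {((⟨i, by omega⟩, ⟨j, hj⟩), (⟨i, hi⟩, ⟨j, by omega⟩)),
       ((⟨i, by omega⟩, ⟨j, hj⟩), (⟨i, hi⟩, ⟨j + 1, by omega⟩)),
       ((⟨i + 1, by omega⟩, ⟨j, hj⟩), (⟨i, hi⟩, ⟨j, by omega⟩)),
       ((⟨i + 1, by omega⟩, ⟨j, hj⟩), (⟨i, hi⟩, ⟨j + 1, by omega⟩))} := by
  ext ⟨⟨⟨a, ha⟩, ⟨b, hb⟩⟩, ⟨⟨c, hc⟩, ⟨d, hd⟩⟩⟩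
  simp only [boundary, IsEdge, evenFace, oddFace, Finset.mem_filter, Finset.mem_univ, true_and,
    Finset.mem_insert, Finset.mem_singleton, Sum.inr.injEq, Prod.mk.injEq, Fin.mk.injEq,
    reduceCtorEq, false_or]
  omega

open Classical in
theorem boundary_even {i j : ℕ} (hi : i + 1 < k) (hj : j + 1 < k) :
    boundary (Sum.inl (⟨i + 1, by omega⟩, ⟨j + 1, by omega⟩) : Face k) =
      {((⟨i + 1, by omega⟩, ⟨j, by omega⟩), (⟨i, by omega⟩, ⟨j + 1, by omega⟩)),
       ((⟨i + 1, by omega⟩, ⟨j, by omega⟩), (⟨i + 1, hi⟩, ⟨j + 1, by omega⟩)),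
       ((⟨i + 1, by omega⟩, ⟨j + 1, hj⟩), (⟨i, by omega⟩, ⟨j + 1, by omega⟩)),
       ((⟨i + 1, by omega⟩, ⟨j + 1, hj⟩), (⟨i + 1, hi⟩, ⟨j + 1, by omega⟩))} := by
  ext ⟨⟨⟨a, ha⟩, ⟨b, hb⟩⟩, ⟨⟨c, hc⟩, ⟨d, hd⟩⟩⟩
  simp only [boundary, IsEdge, evenFace, oddFace, Finset.mem_filter, Finset.mem_univ, true_and,
    Finset.mem_insert, Finset.mem_singleton, Sum.inl.injEq, Prod.mk.injEq, Fin.mk.injEq,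
    reduceCtorEq, or_false]
  omega

theorem IsKasteleyn.odd {φ : White k → Black k → ℤˣ} (hφ : IsKasteleyn φ) {i j : ℕ} (hi : i < k)
    (hj : j < k) : extend φ i j i j * extend φ i j i (j + 1) * extend φ (i + 1) j i j *
      extend φ (i + 1) j i (j + 1) = -1 := by
  classical
  have h := hφ (Sum.inr (⟨i, hi⟩, ⟨j, hj⟩)) trivial
  rw [boundary_odd hi hj] at h
  rw [Finset.prod_insert (by simp), Finset.prod_insert (by simp), Finset.prod_insert (by simp),
    Finset.prod_singleton, Finset.card_insert_of_notMem (by simp),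
    Finset.card_insert_of_notMem (by simp), Finset.card_insert_of_notMem (by simp),
    Finset.card_singleton] at h
  have e1 : i < k + 1 := by omega
  have e2 : j < k + 1 := by omega
  simp only [extend, e1, e2, hi, hj, Nat.add_lt_add_iff_right, and_self, dite_true]
  rw [mul_assoc, mul_assoc, h]
  rfl

theorem IsKasteleyn.even {φ : White k → Black k → ℤˣ} (hφ : IsKasteleyn φ) {i j : ℕ}
    (hi : i + 1 < k) (hj : j + 1 < k) :
    extend φ (i + 1) j i (j + 1) * extend φ (i + 1) j (i + 1) (j + 1) *
      extend φ (i + 1) (j + 1) i (j + 1) * extend φ (i + 1) (j + 1) (i + 1) (j + 1) = -1 := by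
  classical
  have h := hφ (Sum.inl (⟨i + 1, by omega⟩, ⟨j + 1, by omega⟩))
    ⟨Nat.succ_pos _, hi, Nat.succ_pos _, hj⟩
  rw [boundary_even hi hj] at h
  rw [Finset.prod_insert (by simp), Finset.prod_insert (by simp), Finset.prod_insert (by simp),
    Finset.prod_singleton, Finset.card_insert_of_notMem (by simp),
    Finset.card_insert_of_notMem (by simp), Finset.card_insert_of_notMem (by simp),
    Finset.card_singleton] at h
  have e1 : i < k := by omega
  have e2 : j < k := by omega
  simp only [extend, e1, e2, hi, hj, Nat.add_lt_add_iff_right, and_self, dite_true]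
  rw [mul_assoc, mul_assoc, h]
  rfl

theorem refSign_odd {i j : ℕ} (hi : i < k) (hj : j < k) :
    extend (refSign (k := k)) i j i j * extend (refSign (k := k)) i j i (j + 1) *
      extend (refSign (k := k)) (i + 1) j i j *
      extend (refSign (k := k)) (i + 1) j i (j + 1) = -1 := by
  have e1 : i < k + 1 := by omega
  have e2 : j < k + 1 := by omega
  simp [extend, refSign, e1, e2, hi, hj]

theorem refSign_even {i j : ℕ} (hi : i + 1 < k) (hj : j + 1 < k) :
    extend (refSign (k := k)) (i + 1) j i (j + 1) *
      extend (refSign (k := k)) (i + 1) j (i + 1) (j + 1) *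
      extend (refSign (k := k)) (i + 1) (j + 1) i (j + 1) *
      extend (refSign (k := k)) (i + 1) (j + 1) (i + 1) (j + 1) = -1 := by
  have e1 : i < k := by omega
  have e2 : j < k := by omega
  simp [extend, refSign, e1, e2, hi, hj]

/-- A sign function with trivial monodromy around all internal faces is a coboundary. -/
theorem exists_gauge (ψ : ℕ → ℕ → ℕ → ℕ → ℤˣ)
    (hodd : ∀ i j, i < k → j < k →
      ψ i j i j * ψ i j i (j + 1) * ψ (i + 1) j i j * ψ (i + 1) j i (j + 1) = 1)
    (heven : ∀ i j, i + 1 < k → j + 1 < k →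
      ψ (i + 1) j i (j + 1) * ψ (i + 1) j (i + 1) (j + 1) *
        ψ (i + 1) (j + 1) i (j + 1) * ψ (i + 1) (j + 1) (i + 1) (j + 1) = 1) :
    ∃ s t : ℕ → ℕ → ℤˣ, ∀ i j i' j', i < k + 1 → j < k → i' < k → j' < k + 1 →
      (i = i' ∨ i = i' + 1) → (j' = j ∨ j' = j + 1) → ψ i j i' j' = s i j * t i' j' := by
  -- Integrate `ψ` along a spanning tree: along the bottom row, then up each column of black
  -- vertices.
  obtain ⟨τ, hτ⟩ : ∃ τ : ℕ → ℤˣ, ∀ i, τ (i + 1) = τ i * ψ (i + 1) 0 i 0 * ψ (i + 1) 0 (i + 1) 0 :=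
    ⟨fun n => Nat.rec 1 (fun i x => x * ψ (i + 1) 0 i 0 * ψ (i + 1) 0 (i + 1) 0) n, fun _ => rfl⟩
  set t : ℕ → ℕ → ℤˣ := fun i j => τ i * ∏ l ∈ Finset.range j, (ψ i l i l * ψ i l i (l + 1))
    with ht
  have ht0 : ∀ i, t i 0 = τ i := fun i => by simp [ht]
  have hts : ∀ i j, t i (j + 1) = t i j * (ψ i j i j * ψ i j i (j + 1)) := fun i j => by
    simp only [ht, Finset.prod_range_succ, mul_assoc]
  -- White vertices of the last column have only west neighbours, so `s` is fixed there by a west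
  -- edge.
  set s : ℕ → ℕ → ℤˣ := fun i j => if i < k then t i j * ψ i j i j
    else t (i - 1) j * ψ i j (i - 1) j with hs
  have hs1 : ∀ i j, i < k → s i j = t i j * ψ i j i j := fun i j hi => if_pos hi
  have hs2 : ∀ i j, i + 1 = k → s (i + 1) j = t i j * ψ (i + 1) j i j := fun i j hi => by
    subst hi
    simp [hs]
  have c1 : ∀ i j, i < k → ψ i j i j = s i j * t i j := by
    intro i j hi
    rw [hs1 i j hi]
    rcases Int.units_eq_one_or (t i j) with h | h <;> simp [h]
  have c2 : ∀ i j, i < k → ψ i j i (j + 1) = s i j * t i (j + 1) := by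
    intro i j hi
    rw [hs1 i j hi, hts]
    rcases Int.units_eq_one_or (t i j) with h | h <;>
      rcases Int.units_eq_one_or (ψ i j i j) with h' | h' <;> simp [h, h']
  have step1 : ∀ i j, i < k → j < k → ψ (i + 1) j i j = s (i + 1) j * t i j →
      ψ (i + 1) j i (j + 1) = s (i + 1) j * t i (j + 1) := by
    intro i j hi hj h
    have := hodd i j hi hj
    rw [c1 i j hi, c2 i j hi, h] at this
    revert this
    generalize ψ (i + 1) j i (j + 1) = x, s (i + 1) j = a, t i (j + 1) = b, t i j = c, s i j = d
    revert x a b c d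
    decide
  have step2 : ∀ i j, i + 1 < k → j + 1 < k → ψ (i + 1) j i (j + 1) = s (i + 1) j * t i (j + 1) →
      ψ (i + 1) (j + 1) i (j + 1) = s (i + 1) (j + 1) * t i (j + 1) := by
    intro i j hi hj h
    have := heven i j hi hj
    rw [c2 (i + 1) j hi, c1 (i + 1) (j + 1) hi, h] at this
    revert this
    generalize ψ (i + 1) (j + 1) i (j + 1) = x, s (i + 1) j = a, t i (j + 1) = b,
      t (i + 1) (j + 1) = c, s (i + 1) (j + 1) = d
    revert x a b c d
    decide
  -- West edges off the tree are reached from below, crossing an odd face (`step1`) and then an even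
  -- face (`step2`).
  have c3 : ∀ i j, i < k → j < k → ψ (i + 1) j i j = s (i + 1) j * t i j := by
    intro i j hi
    rcases Nat.lt_or_ge (i + 1) k with hi' | hi'
    · induction j with
      | zero =>
        intro _
        rw [hs1 _ _ hi', ht0, ht0, hτ]
        generalize τ i = a, ψ (i + 1) 0 i 0 = b, ψ (i + 1) 0 (i + 1) 0 = c
        revert a b c
        decide
      | succ j ih =>
        intro hj
        exact step2 i j hi' hj (step1 i j hi (by omega) (ih (by omega)))
    · intro _
      rw [hs2 i j (by omega)]
      rcases Int.units_eq_one_or (t i j) with h | h <;> simp [h]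
  refine ⟨s, t, ?_⟩
  rintro i j i' j' h1 h2 h3 h4 (rfl | rfl) (rfl | rfl)
  · exact c1 _ _ h3
  · exact c2 _ _ h3
  · exact c3 _ _ h3 h2
  · exact step1 _ _ h3 h2 (c3 _ _ h3 h2)

/-- A Kasteleyn orientation computes signs of matchings. -/
theorem IsKasteleyn.sign_mul_prod {φ : White k → Black k → ℤˣ} (hφ : IsKasteleyn φ) :
    ∃ ε : ℤˣ, ∀ τ : White k ≃ Black k, (∀ w, IsEdge w (τ w)) →
      ∏ w, φ w (τ w) = ε * Equiv.Perm.sign (matchPerm τ) := by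
  obtain ⟨s, t, hst⟩ := exists_gauge (k := k)
    (fun i j i' j' => extend φ i j i' j' * extend (refSign (k := k)) i j i' j')
    (fun i j hi hj => by
      refine Eq.trans ?_ (congrArg₂ (· * ·) (hφ.odd hi hj) (refSign_odd hi hj))
      ac_rfl)
    (fun i j hi hj => by
      refine Eq.trans ?_ (congrArg₂ (· * ·) (hφ.even hi hj) (refSign_even hi hj))
      ac_rfl)
  have hφr : ∀ w b, IsEdge w b → φ w b = s w.1 w.2 * t b.1 b.2 * refSign w b := by
    intro w b h
    have := hst w.1 w.2 b.1 b.2 w.1.isLt w.2.isLt b.1.isLt b.2.isLt h.1 h.2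
    rw [extend_coe, extend_coe] at this
    rw [← this, mul_assoc, Int.units_mul_self, mul_one]
  by_cases hex : ∃ τ₀ : White k ≃ Black k, ∀ w, IsEdge w (τ₀ w)
  · obtain ⟨τ₀, h₀⟩ := hex
    refine ⟨(∏ w : White k, s w.1 w.2) * (∏ b : Black k, t b.1 b.2) *
      (Equiv.Perm.sign (matchPerm τ₀) * ∏ w, refSign w (τ₀ w)), fun τ h => ?_⟩
    rw [← sign_mul_prod_refSign τ τ₀ h h₀, Finset.prod_congr rfl fun w _ => hφr w (τ w) (h w),
      Finset.prod_mul_distrib, Finset.prod_mul_distrib,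
      Equiv.prod_comp τ (fun b : Black k => t b.1 b.2)]
    rw [mul_comm (Equiv.Perm.sign _), ← mul_assoc, mul_assoc _ (Equiv.Perm.sign _),
      Int.units_mul_self, mul_one]
  · exact ⟨1, fun τ h => (hex ⟨τ, h⟩).elim⟩

end Gauge

/-! ### The partition function as a determinant -/

section Determinant

variable {k : ℕ} {R : Type*} [CommRing R]

/-- The incidence matrix of the path with vertices `0, …, k`. -/
def inc (k : ℕ) (R : Type*) [CommRing R] (i : Fin (k + 1)) (j : Fin k) : R :=
  (if i = j.castSucc then 1 else 0) - if i = j.succ then 1 else 0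

/-- The matrix whose determinant is, up to sign, the partition function. -/
def edgeMatrix (x : Face k → R) : Matrix (White k) (Black k) R := fun w b =>
  inc k R w.1 b.1 * inc k R b.2 w.2 * (x (evenFace w b) - x (oddFace w b))

theorem edgeMatrix_of_isEdge (x : Face k → R) {w : White k} {b : Black k} (h : IsEdge w b) :
    edgeMatrix x w b = x (rightFace (w, b, true)) - x (rightFace (w, b, false)) := by
  obtain ⟨⟨i, hi⟩, ⟨j, hj⟩⟩ := w
  obtain ⟨⟨i', hi'⟩, ⟨j', hj'⟩⟩ := b
  obtain ⟨h1 | h1, h2 | h2⟩ := h <;> simp only at h1 h2 <;> subst h1 <;> subst h2 <;>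
    simp [edgeMatrix, inc, rightFace]

theorem edgeMatrix_of_not_isEdge (x : Face k → R) {w : White k} {b : Black k}
    (h : ¬ IsEdge w b) : edgeMatrix x w b = 0 := by
  simp only [IsEdge, not_and_or, not_or] at h
  simp only [edgeMatrix, inc, Fin.ext_iff, Fin.val_castSucc, Fin.val_succ]
  rcases h with h | h <;> simp [h.1, h.2]

/-- The set of directed edges given by a matching and a choice of directions. -/
def toDimer (τ : White k ≃ Black k) (o : White k → Bool) : Finset (DirEdge k) :=
  Finset.univ.map ⟨fun w => (w, τ w, o w), fun _ _ h => congrArg Prod.fst h⟩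

theorem mem_toDimer {τ : White k ≃ Black k} {o : White k → Bool} {e : DirEdge k} :
    e ∈ toDimer τ o ↔ (e.1, τ e.1, o e.1) = e := by
  simp only [toDimer, Finset.mem_map, Finset.mem_univ, true_and]
  constructor
  · rintro ⟨w, rfl⟩; rfl
  · intro h; exact ⟨e.1, h⟩

theorem isOrientedDimer_toDimer {τ : White k ≃ Black k} (h : ∀ w, IsEdge w (τ w))
    (o : White k → Bool) : IsOrientedDimer (toDimer τ o) := by
  refine ⟨fun e he => ?_, fun w => ⟨(w, τ w, o w), ⟨?_, rfl⟩, ?_⟩,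
    fun b => ⟨(τ.symm b, b, o (τ.symm b)), ⟨?_, rfl⟩, ?_⟩⟩
  · rw [mem_toDimer] at he
    rw [← he]; exact h _
  · rw [mem_toDimer]
  · rintro e ⟨he, rfl⟩
    exact (mem_toDimer.1 he).symm
  · rw [mem_toDimer]; simp
  · rintro e ⟨he, rfl⟩
    rw [mem_toDimer] at he
    rw [← he]; simp

theorem exists_toDimer {M : Finset (DirEdge k)} (hM : IsOrientedDimer M) :
    ∃ (τ : White k ≃ Black k) (o : White k → Bool), (∀ w, IsEdge w (τ w)) ∧ toDimer τ o = M := by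
  obtain ⟨h1, h2, h3⟩ := hM
  choose e he heu using h2
  have hinj : Function.Injective fun w => (e w).2.1 := by
    intro w w' hw
    obtain ⟨f, -, hf⟩ := h3 (e w).2.1
    have := (hf _ ⟨(he w).1, rfl⟩).trans (hf _ ⟨(he w').1, hw.symm⟩).symm
    rw [← (he w).2, this, (he w').2]
  have hbij : Function.Bijective fun w => (e w).2.1 := by
    refine (Fintype.bijective_iff_injective_and_card _).2 ⟨hinj, ?_⟩
    simp [mul_comm]
  refine ⟨Equiv.ofBijective _ hbij, fun w => (e w).2.2, fun w => ?_, ?_⟩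
  · have := h1 _ (he w).1
    rw [(he w).2] at this
    exact this
  · ext f
    rw [mem_toDimer]
    constructor
    · intro hf
      have h4 : f = e f.1 := by
        conv_lhs => rw [← hf]
        exact Prod.ext (he f.1).2.symm rfl
      rw [h4]; exact (he f.1).1
    · intro hf
      have h4 : f = e f.1 := heu f.1 f ⟨hf, rfl⟩
      conv_rhs => rw [h4]
      exact Prod.ext (he f.1).2.symm rfl

/-- The two directions of an edge have opposite signs and opposite right faces; expanding the
product of these differences chooses a direction for each edge. -/
theorem Z_eq_sum_matchings (x : Face k → R) (φ : White k → Black k → ℤˣ) :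
    Z k x φ = ∑ τ : White k ≃ Black k, ∏ w, (((φ w (τ w) : ℤˣ) : ℤ) : R) * edgeMatrix x w (τ w) := by
  classical
  set g : DirEdge k → R := fun e => if IsEdge e.1 e.2.1 then
    (((dirSign φ e : ℤˣ) : ℤ) : R) * x (rightFace e) else 0 with hg
  have h1 : ∀ w b, (((φ w b : ℤˣ) : ℤ) : R) * edgeMatrix x w b = ∑ o : Bool, g (w, b, o) := by
    intro w b
    by_cases h : IsEdge w b
    · rw [edgeMatrix_of_isEdge x h]
      simp [hg, h, dirSign]
      ring
    · simp [edgeMatrix_of_not_isEdge x h, hg, h]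
  simp_rw [h1, Finset.prod_univ_sum, Fintype.piFinset_univ]
  rw [← Fintype.sum_prod_type', ← Finset.sum_filter_of_ne
    (p := fun q : (White k ≃ Black k) × (White k → Bool) => ∀ w, IsEdge w (q.1 w))]
  · symm
    refine Finset.sum_bij (fun q _ => toDimer q.1 q.2) ?_ ?_ ?_ ?_
    · intro q hq
      rw [Finset.mem_filter] at hq ⊢
      exact ⟨Finset.mem_univ _, isOrientedDimer_toDimer hq.2 _⟩
    · rintro ⟨τ, o⟩ _ ⟨τ', o'⟩ _ h
      have key : ∀ w, (w, τ' w, o' w) = (w, τ w, o w) := fun w => by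
        have hm : (w, τ w, o w) ∈ toDimer τ o := mem_toDimer.2 rfl
        dsimp only at h
        rw [h] at hm
        exact mem_toDimer.1 hm
      simp only [Prod.mk.injEq, true_and] at key
      exact Prod.ext (Equiv.ext fun w => (key w).1.symm) (funext fun w => (key w).2.symm)
    · intro M hM
      obtain ⟨τ, o, h, rfl⟩ := exists_toDimer (Finset.mem_filter.1 hM).2
      exact ⟨(τ, o), Finset.mem_filter.2 ⟨Finset.mem_univ _, h⟩, rfl⟩
    · rintro ⟨τ, o⟩ hq
      rw [toDimer, Finset.prod_map]
      refine Finset.prod_congr rfl fun w _ => ?_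
      exact if_pos ((Finset.mem_filter.1 hq).2 w)
  · intro q _ hq w
    by_contra hc
    exact hq (Finset.prod_eq_zero (Finset.mem_univ w) (if_neg hc))

/-- The partition function is a determinant, up to sign. -/
theorem IsKasteleyn.Z_eq_det {φ : White k → Black k → ℤˣ} (hφ : IsKasteleyn φ) (x : Face k → R) :
    ∃ ε : ℤˣ, Z k x φ = ((ε : ℤ) : R) *
      ((edgeMatrix x).submatrix (whiteIdx k).symm (blackIdx k).symm).det := by
  obtain ⟨ε, hε⟩ := hφ.sign_mul_prod
  refine ⟨ε, ?_⟩
  rw [← Matrix.det_transpose, Matrix.det_apply', Z_eq_sum_matchings, Finset.mul_sum,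
    ← Equiv.sum_comp (Equiv.equivCongr (whiteIdx k) (blackIdx k))]
  refine Finset.sum_congr rfl fun τ _ => ?_
  have hsig : Equiv.equivCongr (whiteIdx k) (blackIdx k) τ = matchPerm τ := rfl
  rw [hsig, ← Equiv.prod_comp (whiteIdx k)]
  have h2 : ∀ w, ((edgeMatrix x).submatrix (whiteIdx k).symm (blackIdx k).symm).transpose
      (matchPerm τ (whiteIdx k w)) (whiteIdx k w) = edgeMatrix x w (τ w) := by
    intro w; simp [matchPerm]
  simp_rw [h2]
  rw [Finset.prod_mul_distrib]
  by_cases h : ∀ w, IsEdge w (τ w)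
  · have := congrArg (fun u : ℤˣ => ((u : ℤ) : R)) (hε τ h)
    push_cast at this
    rw [this, mul_assoc]
  · push Not at h
    obtain ⟨w, hw⟩ := h
    rw [Finset.prod_eq_zero (f := fun w => edgeMatrix x w (τ w)) (Finset.mem_univ w)
      (edgeMatrix_of_not_isEdge x hw)]
    simp

end Determinant

/-! ### Enlargement to a matrix with a column for each face -/

section FaceMatrix

variable {k : ℕ} {R : Type*} [CommRing R]

/-- The incidence coefficients of a white vertex with its adjacent faces. -/
def incFace (R : Type*) [CommRing R] (w : White k) : Face k → R
  | Sum.inl (i, j) => if w.1 = i then inc k R j w.2 else 0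
  | Sum.inr (i, j) => if w.2 = j then inc k R w.1 i else 0

/-- The indicator function of the bottom row of even faces. -/
def bottom (R : Type*) [CommRing R] : Face k → R
  | Sum.inl (_, j) => if j = 0 then 1 else 0
  | Sum.inr _ => 0

/-- A square matrix with one column for each face. -/
def faceMatrix (x y r : Face k → R) : Matrix (White k ⊕ (White k ⊕ Unit)) (Face k) R :=
  Sum.elim (fun w f => x f * incFace R w f)
    (Sum.elim (fun w f => y f * incFace R w f) (fun _ f => r f * bottom R f))

/-- The matrix of a change of variables adapted to `faceMatrix x 1 1`. -/
def baseChange (k : ℕ) (R : Type*) [CommRing R] :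
    Matrix (Face k) (Black k ⊕ (White k ⊕ Unit)) R
  | Sum.inl (i, j), Sum.inl b => if j = b.2 then inc k R i b.1 else 0
  | Sum.inr (i, j), Sum.inl b => if i = b.1 then -inc k R b.2 j else 0
  | Sum.inl (i, j), Sum.inr (Sum.inl w) => if i = w.1 ∧ (w.2 : ℕ) < j then -1 else 0
  | Sum.inl (i, _), Sum.inr (Sum.inr _) => if i = 0 then 1 else 0
  | Sum.inr _, Sum.inr _ => 0

theorem sum_inc_fst (j : Fin k) : ∑ i, inc k R i j = 0 := by
  simp [inc, Finset.sum_sub_distrib]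

theorem sum_inc_mul (f : Fin (k + 1) → R) (j : Fin k) :
    ∑ i, inc k R i j * f i = f j.castSucc - f j.succ := by
  simp [inc, sub_mul, Finset.sum_sub_distrib]

theorem faceMatrix_mul_baseChange₁₁ (x : Face k → R) (w : White k) (b : Black k) :
    (faceMatrix x 1 1 * baseChange k R) (Sum.inl w) (Sum.inl b) = edgeMatrix x w b := by
  rw [Matrix.mul_apply]
  simp only [Fintype.sum_sum_type, Fintype.sum_prod_type, faceMatrix, incFace, baseChange,
    Sum.elim_inl, mul_ite, ite_mul, mul_zero, zero_mul, Finset.sum_ite_eq, Finset.sum_ite_eq',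
    Finset.mem_univ, if_true, edgeMatrix, evenFace, oddFace, Finset.sum_ite_irrel,
    Finset.sum_const_zero]
  ring

/-- Without weights, the even and the odd face of an edge contribute opposite terms; in the bottom
row the columns of `inc` sum to zero. -/
theorem faceMatrix_mul_baseChange₂₁ (x : Face k → R) (b : Black k) (w : White k ⊕ Unit) :
    (faceMatrix x 1 1 * baseChange k R) (Sum.inr w) (Sum.inl b) = 0 := by
  rw [Matrix.mul_apply]
  rcases w with w | w
  · simp only [Fintype.sum_sum_type, Fintype.sum_prod_type, faceMatrix, incFace, baseChange,
      Sum.elim_inl, Sum.elim_inr, mul_ite, ite_mul, mul_zero, zero_mul, Finset.sum_ite_eq,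
      Finset.sum_ite_eq', Finset.mem_univ, if_true, Pi.one_apply, Finset.sum_ite_irrel,
      Finset.sum_const_zero]
    ring
  · simp [Fintype.sum_sum_type, Fintype.sum_prod_type, faceMatrix, bottom, baseChange,
      Finset.sum_ite_irrel, sum_inc_fst]

/-- The non-black columns of `baseChange` are step functions on columns of even faces; differencing
a step gives a delta. -/
theorem faceMatrix_mul_baseChange₂₂ (x : Face k → R) (v w : White k ⊕ Unit) :
    (faceMatrix x 1 1 * baseChange k R) (Sum.inr w) (Sum.inr v) =
      (1 : Matrix (White k ⊕ Unit) (White k ⊕ Unit) R) w v := by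
  rw [Matrix.mul_apply]
  rcases w with w | w <;> rcases v with v | v
  · simp only [Fintype.sum_sum_type, Fintype.sum_prod_type, faceMatrix, incFace, baseChange,
      Sum.elim_inl, Sum.elim_inr, mul_zero, Finset.sum_const_zero, add_zero, Pi.one_apply, one_mul]
    rw [Finset.sum_eq_single w.1 (by intro i _ hi; simp [Ne.symm hi]) (by simp)]
    simp only [if_true]
    rw [sum_inc_mul (fun j => if w.1 = v.1 ∧ (v.2 : ℕ) < j then (-1 : R) else 0)]
    simp only [Matrix.one_apply, Sum.inl.injEq, Prod.ext_iff, Fin.ext_iff, Fin.val_castSucc,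
      Fin.val_succ]
    split_ifs <;> first | omega | simp
  · simp only [Fintype.sum_sum_type, Fintype.sum_prod_type, faceMatrix, incFace, baseChange,
      Sum.elim_inl, Sum.elim_inr, mul_zero, Finset.sum_const_zero, add_zero, Pi.one_apply, one_mul]
    rw [Finset.sum_eq_single w.1 (by intro i _ hi; simp [Ne.symm hi]) (by simp)]
    simp only [if_true]
    rw [sum_inc_mul (fun _ => if w.1 = 0 then (1 : R) else 0)]
    simp
  · simp only [Fintype.sum_sum_type, Fintype.sum_prod_type, faceMatrix, bottom, baseChange,
      Sum.elim_inr, mul_zero, Finset.sum_const_zero, add_zero, Pi.one_apply, one_mul]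
    rw [Matrix.one_apply_ne (by simp)]
    refine Finset.sum_eq_zero fun i _ => Finset.sum_eq_zero fun j _ => ?_
    by_cases hj : j = 0 <;> simp [hj]
  · simp [Fintype.sum_sum_type, Fintype.sum_prod_type, faceMatrix, bottom, baseChange]

theorem card_face : Fintype.card (Face k) = Fintype.card (White k ⊕ (White k ⊕ Unit)) := by
  simp; ring

/-- An enumeration of the rows of `faceMatrix` by the faces. -/
noncomputable def rowEquiv (k : ℕ) : Face k ≃ White k ⊕ (White k ⊕ Unit) :=
  Fintype.equivOfCardEq card_face

/-- `faceMatrix` with rows indexed by the faces. -/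
noncomputable def squareMatrix (x y r : Face k → R) : Matrix (Face k) (Face k) R :=
  (faceMatrix x y r).submatrix (rowEquiv k) id

/-- The product with `baseChange` is block triangular with diagonal blocks `edgeMatrix x` and `1`.
Taking `c` in `R` makes it a scalar even when the weights are polynomial variables. -/
theorem exists_det_edgeMatrix (k : ℕ) (R : Type*) [CommRing R] (S : Type*) [CommRing S]
    (F : R →+* S) : ∃ c : R, ∀ x : Face k → S,
      ((edgeMatrix x).submatrix (whiteIdx k).symm (blackIdx k).symm).det =
        F c * (squareMatrix x 1 1).det := by
  set e₁ : Fin ((k + 1) * k) ⊕ (White k ⊕ Unit) ≃ White k ⊕ (White k ⊕ Unit) :=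
    Equiv.sumCongr (whiteIdx k).symm (Equiv.refl _) with he₁
  set e₂ : Fin ((k + 1) * k) ⊕ (White k ⊕ Unit) ≃ Black k ⊕ (White k ⊕ Unit) :=
    Equiv.sumCongr (blackIdx k).symm (Equiv.refl _) with he₂
  refine ⟨((baseChange k R).submatrix id ((rowEquiv k).trans (e₁.symm.trans e₂))).det,
    fun x => ?_⟩
  have hmap : F ((baseChange k R).submatrix id ((rowEquiv k).trans (e₁.symm.trans e₂))).det =
      ((baseChange k S).submatrix id ((rowEquiv k).trans (e₁.symm.trans e₂))).det := by
    rw [RingHom.map_det]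
    congr 1
    ext f g
    simp only [RingHom.mapMatrix_apply, Matrix.map_apply, Matrix.submatrix_apply]
    generalize ((rowEquiv k).trans (e₁.symm.trans e₂)) g = g'
    rcases id f with ⟨i, j⟩ | ⟨i, j⟩ <;> rcases g' with b | w | w <;>
      simp [baseChange, inc, apply_ite F]
  rw [hmap, mul_comm (Matrix.det (Matrix.submatrix (baseChange k S) _ _)), ← Matrix.det_mul, squareMatrix]
  rw [← Matrix.det_submatrix_equiv_self (e₁.trans (rowEquiv k).symm)]
  have : ((faceMatrix x 1 1).submatrix (rowEquiv k) id *
      (baseChange k S).submatrix id ((rowEquiv k).trans (e₁.symm.trans e₂))).submatrix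
        (e₁.trans (rowEquiv k).symm) (e₁.trans (rowEquiv k).symm) =
      Matrix.fromBlocks ((edgeMatrix x).submatrix (whiteIdx k).symm (blackIdx k).symm)
        (Matrix.of fun a b => (faceMatrix x 1 1 * baseChange k S) (e₁ (Sum.inl a)) (Sum.inr b))
        0 1 := by
    have h2 := Matrix.submatrix_mul_equiv (faceMatrix x 1 1) (baseChange k S) (rowEquiv k)
      (Equiv.refl _) ((rowEquiv k).trans (e₁.symm.trans e₂))
    rw [Equiv.coe_refl] at h2
    rw [h2]
    ext a b
    rw [Matrix.submatrix_apply, Matrix.submatrix_apply]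
    rcases a with a | a <;> rcases b with b | b
    · simpa [he₁, he₂] using faceMatrix_mul_baseChange₁₁ x _ _
    · simp [he₁, he₂]
    · simpa [he₁, he₂] using faceMatrix_mul_baseChange₂₁ x _ _
    · simpa [he₁, he₂] using faceMatrix_mul_baseChange₂₂ x _ _
  rw [this, Matrix.det_fromBlocks_zero₂₁, Matrix.det_one, mul_one]

end FaceMatrix

/-! ### Homogenization of multilinear polynomials -/

section Homogenization

variable {σ : Type*} [Fintype σ]

theorem homEval_eq_sum {P : MvPolynomial σ ℂ} (x y : σ → ℂ) {T : Finset (σ →₀ ℕ)}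
    (h : P.support ⊆ T) : homEval P x y =
      ∑ s ∈ T, P.coeff s * ∏ f, (x f ^ (s f : ℤ) * y f ^ (1 - (s f : ℤ))) := by
  refine Finset.sum_subset h fun s _ hs => ?_
  rw [MvPolynomial.notMem_support_iff.1 hs, zero_mul]

theorem homEval_add (P Q : MvPolynomial σ ℂ) (x y : σ → ℂ) :
    homEval (P + Q) x y = homEval P x y + homEval Q x y := by
  classical
  rw [homEval_eq_sum x y (T := P.support ∪ Q.support) MvPolynomial.support_add,
    homEval_eq_sum x y (P := P) Finset.subset_union_left,
    homEval_eq_sum x y (P := Q) Finset.subset_union_right, ← Finset.sum_add_distrib]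
  refine Finset.sum_congr rfl fun s _ => ?_
  rw [MvPolynomial.coeff_add, add_mul]

theorem homEval_sum {ι : Type*} (T : Finset ι) (P : ι → MvPolynomial σ ℂ) (x y : σ → ℂ) :
    homEval (∑ i ∈ T, P i) x y = ∑ i ∈ T, homEval (P i) x y := by
  classical
  induction T using Finset.induction_on with
  | empty => simp [homEval]
  | insert a T ha ih => rw [Finset.sum_insert ha, Finset.sum_insert ha, homEval_add, ih]

theorem homEval_squarefree [DecidableEq σ] (q : ℂ) (S : Finset σ) (x y : σ → ℂ) :
    homEval (MvPolynomial.C q * ∏ f ∈ S, MvPolynomial.X f) x y =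
      q * ∏ f, if f ∈ S then x f else y f := by
  have h : MvPolynomial.C q * ∏ f ∈ S, MvPolynomial.X f =
      MvPolynomial.monomial (∑ f ∈ S, Finsupp.single f 1) q := by
    rw [← mul_one q, ← MvPolynomial.C_mul_monomial, MvPolynomial.monomial_sum_one, mul_one]
    rfl
  rw [h, homEval_eq_sum x y MvPolynomial.support_monomial_subset, Finset.sum_singleton,
    MvPolynomial.coeff_monomial, if_pos rfl]
  congr 1
  refine Finset.prod_congr rfl fun f _ => ?_
  have h2 : (∑ g ∈ S, Finsupp.single g 1 : σ →₀ ℕ) f = if f ∈ S then 1 else 0 := by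
    simp [Finsupp.finsetSum_apply, Finsupp.single_apply]
  rw [h2]
  split_ifs <;> simp

theorem det_mul_add_mul {R : Type*} [CommRing R] [DecidableEq σ] (A B : Matrix σ σ R)
    (x y : σ → R) : (Matrix.of fun f g => x f * A f g + y f * B f g).det =
      ∑ S : Finset σ, (∏ f, if f ∈ S then x f else y f) *
        (Matrix.of fun f g => if f ∈ S then A f g else B f g).det := by
  have := (Matrix.detRowAlternating (n := σ) (R := R)).toMultilinearMap.map_add_univ
    (fun f => x f • A f) (fun f => y f • B f)
  refine Eq.trans this (Finset.sum_congr rfl fun S _ => ?_)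
  rw [← Matrix.det_mul_column]
  refine congrArg Matrix.det (Matrix.ext fun f g => ?_)
  by_cases h : f ∈ S <;> simp [Finset.piecewise, h]

end Homogenization

/-! ### The ratio function from a kernel vector -/

section Kernel

variable {k : ℕ}

theorem squareMatrix_apply {R : Type*} [CommRing R] (x y r : Face k → R) (f g : Face k) :
    squareMatrix x y r f g = faceMatrix x y r (rowEquiv k f) g := rfl

/-- Column `f` is linear in `(x f, y f)`. The coefficients are scalars, so this determinant is the
homogenization of its value at `y = 1`. -/
theorem det_squareMatrix {R : Type*} [CommRing R] (x y : Face k → R) (F : ℂ →+* R) :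
    (squareMatrix x y y).det = ∑ S : Finset (Face k), (∏ f, if f ∈ S then x f else y f) *
      F (Matrix.of fun f g => if f ∈ S then squareMatrix (R := ℂ) 1 0 0 g f
        else squareMatrix (R := ℂ) 0 1 1 g f).det := by
  have hF : ∀ w f, F (incFace ℂ w f) = incFace R (k := k) w f := by
    rintro w (⟨i, j⟩ | ⟨i, j⟩) <;> simp [incFace, inc, apply_ite F]
  have hB : ∀ f, F (bottom ℂ f) = bottom R (k := k) f := by
    rintro (⟨i, j⟩ | ⟨i, j⟩) <;> simp [bottom, apply_ite F]
  rw [← Matrix.det_transpose]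
  have h := det_mul_add_mul (fun f g => F (squareMatrix (R := ℂ) 1 0 0 g f))
    (fun f g => F (squareMatrix (R := ℂ) 0 1 1 g f)) x y
  refine Eq.trans (congrArg Matrix.det (Matrix.ext fun f g => ?_)) (h.trans ?_)
  · simp only [squareMatrix_apply, Matrix.transpose_apply, Matrix.of_apply]
    rcases rowEquiv k g with w | w | w <;> simp [faceMatrix, hF, hB]
  · refine Finset.sum_congr rfl fun S _ => ?_
    rw [RingHom.map_det]
    congr 2
    ext f g
    simp [apply_ite F]

/-- The homogenized partition function is proportional to the determinant of `squareMatrix`. -/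
theorem IsKasteleyn.homEval_Zpoly {φ : White k → Black k → ℤˣ} (hφ : IsKasteleyn φ) :
    ∃ c : ℂ, ∀ x y, homEval (Zpoly k φ) x y = c * (squareMatrix x y y).det := by
  classical
  obtain ⟨ε, hε⟩ := hφ.Z_eq_det (R := MvPolynomial (Face k) ℂ) MvPolynomial.X
  obtain ⟨c, hc⟩ := exists_det_edgeMatrix k ℂ (MvPolynomial (Face k) ℂ) MvPolynomial.C
  refine ⟨((ε : ℤ) : ℂ) * c, fun x y => ?_⟩
  have h1 : Zpoly k φ = ∑ S : Finset (Face k), MvPolynomial.C (((ε : ℤ) : ℂ) * c *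
      (Matrix.of fun f g => if f ∈ S then squareMatrix (R := ℂ) 1 0 0 g f
        else squareMatrix (R := ℂ) 0 1 1 g f).det) * ∏ f ∈ S, MvPolynomial.X f := by
    rw [Zpoly, hε, hc, det_squareMatrix _ _ MvPolynomial.C, Finset.mul_sum, Finset.mul_sum]
    refine Finset.sum_congr rfl fun S _ => ?_
    have h2 : (∏ f, if f ∈ S then (MvPolynomial.X f : MvPolynomial (Face k) ℂ)
        else (1 : Face k → MvPolynomial (Face k) ℂ) f) = ∏ f ∈ S, MvPolynomial.X f := by
      simp [Finset.prod_ite_mem]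
    rw [h2, MvPolynomial.C_mul, MvPolynomial.C_mul, map_intCast]
    ring
  rw [h1, homEval_sum, det_squareMatrix x y (RingHom.id ℂ), Finset.mul_sum]
  refine Finset.sum_congr rfl fun S _ => ?_
  rw [homEval_squarefree, RingHom.id_apply]
  ring

/-- The sign relating the two determinants obtained by exchanging homogeneous coordinates. -/
noncomputable def swapSign (k : ℕ) : ℂ :=
  ((Equiv.Perm.sign (((rowEquiv k).trans ((Equiv.sumAssoc _ _ _).symm.trans
    ((Equiv.sumCongr (Equiv.sumComm _ _) (Equiv.refl _)).trans (Equiv.sumAssoc _ _ _)))).trans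
      (rowEquiv k).symm) : ℤ) : ℂ)

theorem det_squareMatrix_swap (x y r : Face k → ℂ) :
    (squareMatrix y x r).det = swapSign k * (squareMatrix x y r).det := by
  rw [swapSign, ← Matrix.det_permute]
  refine congrArg Matrix.det (Matrix.ext fun f g => ?_)
  simp only [squareMatrix_apply, Matrix.submatrix_apply, Equiv.trans_apply, Equiv.apply_symm_apply, id]
  rcases rowEquiv k f with w | w | w <;> rfl

/-- Apply the adjugate to `N u`, which is supported at `i₀`. The last factor does not involve row
`i₀` of `N`, so it cancels between matrices differing only there. -/
theorem det_mul_of_mulVec {n R : Type*} [Fintype n] [DecidableEq n] [CommRing R]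
    (N : Matrix n n R) (u : n → R) (i₀ : n) (h : ∀ i, i ≠ i₀ → N.mulVec u i = 0) (f : n) :
    N.det * u f = N.mulVec u i₀ * (N.updateRow i₀ (Pi.single f 1)).det := by
  have h1 : N.adjugate.mulVec (N.mulVec u) f = N.det * u f := by
    rw [Matrix.mulVec_mulVec, Matrix.adjugate_mul, Matrix.smul_mulVec, Matrix.one_mulVec]
    rfl
  rw [← h1, Matrix.mulVec, dotProduct, Finset.sum_eq_single i₀, Matrix.adjugate_apply, mul_comm]
  · intro i _ hi; rw [h i hi, mul_zero]
  · simp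

theorem squareMatrix_mulVec (x y r u : Face k → ℂ) (f : Face k) :
    (squareMatrix x y r).mulVec u f =
      Sum.elim (fun w => ∑ g, x g * incFace ℂ w g * u g)
        (Sum.elim (fun w => ∑ g, y g * incFace ℂ w g * u g)
          (fun _ => ∑ g, r g * bottom ℂ g * u g)) (rowEquiv k f) := by
  simp only [squareMatrix_apply, Matrix.mulVec, dotProduct]
  rcases rowEquiv k f with w | w | w <;> rfl

/-- The ratio function is computed by any nonzero solution of the linear system attached to the
white vertices. -/
theorem Y_eq_of_kernel {φ : White k → Black k → ℤˣ} (hφ : IsKasteleyn φ)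
    (a : Face k → OnePoint ℂ) (hY : YDefined k φ a) (u : Face k → ℂ) (hu : u ≠ 0)
    (hX : ∀ w, ∑ g, coordX (a g) * incFace ℂ w g * u g = 0)
    (hY' : ∀ w, ∑ g, coordY (a g) * incFace ℂ w g * u g = 0) {X Y₀ : ℂ}
    (eX : ∑ g, coordX (a g) * bottom ℂ g * u g = X)
    (eY : ∑ g, coordY (a g) * bottom ℂ g * u g = Y₀) :
    Y k φ a = if Y₀ = 0 then ∞ else ((swapSign k * (X / Y₀) : ℂ) : OnePoint ℂ) := by
  obtain ⟨c, hc⟩ := hφ.homEval_Zpoly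
  set x : Face k → ℂ := fun f => coordX (a f) with hx
  set y : Face k → ℂ := fun f => coordY (a f) with hy
  have hnum : numY k φ a = c * (swapSign k * (squareMatrix x y x).det) := by
    rw [← det_squareMatrix_swap, ← hc]; rfl
  have hden : denY k φ a = c * (squareMatrix x y y).det := hc _ _
  set i₀ := (rowEquiv k).symm (Sum.inr (Sum.inr ())) with hi₀
  have hker : ∀ r : Face k → ℂ, ∀ i, i ≠ i₀ → (squareMatrix x y r).mulVec u i = 0 := by
    intro r i hi
    rw [squareMatrix_mulVec]
    have : rowEquiv k i ≠ Sum.inr (Sum.inr ()) := fun h => hi (by rw [hi₀, ← h]; simp)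
    revert this
    rcases rowEquiv k i with w | w | w
    · exact fun _ => hX w
    · exact fun _ => hY' w
    · exact fun h => (h rfl).elim
  have hval : ∀ r : Face k → ℂ, (squareMatrix x y r).mulVec u i₀ = ∑ g, r g * bottom ℂ g * u g := by
    intro r
    rw [squareMatrix_mulVec, hi₀]
    simp
  obtain ⟨f, hf⟩ := Function.ne_iff.1 hu
  set q := ((squareMatrix x y 0).updateRow i₀ (Pi.single f 1)).det with hq
  have hdet : ∀ r : Face k → ℂ, (squareMatrix x y r).det * u f =
      (∑ g, r g * bottom ℂ g * u g) * q := by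
    intro r
    rw [det_mul_of_mulVec _ u i₀ (hker r), hval]
    congr 2
    ext i j
    by_cases hi : i = i₀
    · subst hi; simp
    · rw [Matrix.updateRow_ne hi, Matrix.updateRow_ne hi]
      have : rowEquiv k i ≠ Sum.inr (Sum.inr ()) := fun h => hi (by rw [hi₀, ← h]; simp)
      simp only [squareMatrix_apply]
      revert this
      rcases rowEquiv k i with w | w | w
      · exact fun _ => rfl
      · exact fun _ => rfl
      · exact fun h => (h rfl).elim
  have dX := hdet x
  have dY := hdet y
  rw [eX] at dX
  rw [eY] at dY
  have hf' : u f ≠ 0 := hf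
  have dX' : (squareMatrix x y x).det = X * (q / u f) := by
    field_simp; exact dX
  have dY' : (squareMatrix x y y).det = Y₀ * (q / u f) := by
    field_simp; exact dY
  rw [dX'] at hnum
  rw [dY'] at hden
  -- Neither `c` nor the cofactor `q` needs to be computed: if one vanished, `Y` would be `0 / 0`.
  have hc0 : c ≠ 0 := by
    rintro rfl
    exact hY ⟨by rw [hnum, zero_mul], by rw [hden, zero_mul]⟩
  have hq0 : q / u f ≠ 0 := by
    intro h
    exact hY ⟨by rw [hnum, h]; ring, by rw [hden, h]; ring⟩
  rw [Y, hnum, hden]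
  by_cases hY0 : Y₀ = 0
  · simp [hY0]
  · rw [if_neg hY0, if_neg (mul_ne_zero hc0 (mul_ne_zero hY0 hq0))]
    have hq1 : q ≠ 0 := fun h => hq0 (by rw [h, zero_div])
    congr 1
    field_simp

end Kernel

/-! ### Periodic solutions on the cylinder -/

section Periodic

variable {k m : ℕ}

theorem eq_zero_of_sum_inc_mul {f : Fin k → ℂ} (h : ∀ i, ∑ l, inc k ℂ i l * f l = 0) :
    f = 0 := by
  suffices H : ∀ (n : ℕ) (hn : n < k), f ⟨n, hn⟩ = 0 from funext fun l => H l l.isLt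
  intro n
  induction n using Nat.strong_induction_on with
  | _ n ih =>
    intro hn
    have h1 := h (Fin.castSucc ⟨n, hn⟩)
    simp only [inc, sub_mul, Finset.sum_sub_distrib] at h1
    have h2 : ∑ l, (if Fin.castSucc ⟨n, hn⟩ = l.succ then (1 : ℂ) else 0) * f l = 0 := by
      refine Finset.sum_eq_zero fun l _ => ?_
      split_ifs with hl
      · have : n = l + 1 := by simpa [Fin.ext_iff] using hl
        rw [show f l = 0 from ih l (by omega) l.isLt, mul_zero]
      · rw [zero_mul]
    rw [h2, sub_zero, Finset.sum_eq_single ⟨n, hn⟩, if_pos rfl, one_mul] at h1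
    · exact h1
    · intro l _ hl
      rw [if_neg fun h => hl (Fin.castSucc_injective _ h).symm, zero_mul]
    · simp

/-- The linear equation at a white vertex of the cylinder of circumference `m`, perturbed by a
source at height `0`. -/
def cylinderMap [NeZero m] (P : Fin k → Prop) [DecidablePred P] (c : Fin (k + 1) → ZMod m → ℂ)
    (d : Fin k → ZMod m → ℂ) (e : Fin k → ℂ) :
    ((Fin k × ZMod m → ℂ) × (Fin (k + 1) × ZMod m → ℂ)) × ({l // P l} → ℂ) × ℂ →ₗ[ℂ]
      (Fin (k + 1) × ZMod m → ℂ) where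
  toFun q := fun w => (∑ l, inc k ℂ w.1 l * (d l w.2 * q.1.1 (l, w.2))) +
    (c w.1 w.2 * q.1.2 w - c w.1 (w.2 + 1) * q.1.2 (w.1, w.2 + 1)) +
    (if w.2 = 0 then 1 else 0) * ((∑ l : {l // P l}, inc k ℂ w.1 l * (e l * q.2.1 l)) +
      (if w.1 = Fin.last k then 1 else 0) * q.2.2)
  map_add' q q' := by
    funext w
    simp only [Prod.fst_add, Prod.snd_add, Pi.add_apply, mul_add, Finset.sum_add_distrib]
    ring
  map_smul' z q := by
    funext w
    simp only [Prod.smul_fst, Prod.smul_snd, Pi.smul_apply, smul_eq_mul, RingHom.id_apply]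
    simp_rw [mul_left_comm _ z, ← Finset.mul_sum]
    ring

/-- Summing around the cylinder cancels the terms in `v`. Summing then over `i` kills the columns of
`inc` and leaves `r = 0`; injectivity of `inc` gives the rest. -/
theorem sum_cylinderMap [NeZero m] (P : Fin k → Prop) [DecidablePred P]
    (c : Fin (k + 1) → ZMod m → ℂ) (d : Fin k → ZMod m → ℂ) (e : Fin k → ℂ)
    (u : Fin k × ZMod m → ℂ) (v : Fin (k + 1) × ZMod m → ℂ) (s : {l // P l} → ℂ) (r : ℂ)
    (h : cylinderMap P c d e ((u, v), s, r) = 0) :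
    r = 0 ∧ ∀ l : {l // P l}, ∑ j, d l j * u (l, j) + e l * s l = 0 := by
  have h1 : ∀ i, (∑ l, inc k ℂ i l * (∑ j, d l j * u (l, j))) +
      ((∑ l : {l // P l}, inc k ℂ i l * (e l * s l)) + (if i = Fin.last k then 1 else 0) * r)
        = 0 := by
    intro i
    have h2 : ∑ j, cylinderMap P c d e ((u, v), s, r) (i, j) = 0 := by simp [h]
    simp only [cylinderMap, LinearMap.coe_mk, AddHom.coe_mk, Finset.sum_add_distrib,
      Finset.sum_sub_distrib] at h2
    have h3 : ∑ j, c i (j + 1) * v (i, j + 1) = ∑ j, c i j * v (i, j) :=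
      Equiv.sum_comp (Equiv.addRight (1 : ZMod m)) (fun j => c i j * v (i, j))
    rw [h3, sub_self, add_zero] at h2
    change _ + ∑ j : ZMod m, (if j = 0 then (1 : ℂ) else 0) *
      ((∑ l : {l // P l}, inc k ℂ i l * (e l * s l)) + (if i = Fin.last k then 1 else 0) * r) = 0
      at h2
    rw [← Finset.sum_mul, Finset.sum_ite_eq' _ _ _, if_pos (Finset.mem_univ _), one_mul, Finset.sum_comm] at h2
    simp_rw [← Finset.mul_sum] at h2
    exact h2
  have hr : r = 0 := by
    have h2 : ∑ i, ((∑ l, inc k ℂ i l * (∑ j, d l j * u (l, j))) +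
      ((∑ l : {l // P l}, inc k ℂ i l * (e l * s l)) + (if i = Fin.last k then 1 else 0) * r))
        = 0 := Finset.sum_eq_zero fun i _ => h1 i
    rw [Finset.sum_add_distrib, Finset.sum_add_distrib, Finset.sum_comm,
      Finset.sum_comm (s := Finset.univ) (t := (Finset.univ : Finset {l // P l}))] at h2
    simp_rw [← Finset.sum_mul, sum_inc_fst] at h2
    simpa using h2
  subst hr
  refine ⟨rfl, fun l => ?_⟩
  have h3 : (fun l => (∑ j, d l j * u (l, j)) + if hl : P l then e l * s ⟨l, hl⟩ else 0) = 0 := by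
    refine eq_zero_of_sum_inc_mul fun i => ?_
    have := h1 i
    rw [mul_zero, add_zero] at this
    refine Eq.trans ?_ this
    simp_rw [mul_add]
    rw [Finset.sum_add_distrib]
    congr 1
    rw [← Fintype.sum_subtype_add_sum_subtype P, Finset.sum_congr rfl fun l _ => by
      rw [dif_pos l.2], Finset.sum_eq_zero (s := (Finset.univ : Finset {l // ¬ P l})) fun l _ => by
      rw [dif_neg l.2, mul_zero], add_zero]
  have := congrFun h3 l
  simpa [l.2] using this

/-- Existence of periodic solutions, when sufficiently many columns are constant. -/
theorem exists_periodic_kernel [NeZero m] (P : Fin k → Prop) [DecidablePred P]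
    (cx cy : Fin (k + 1) → ZMod m → ℂ) (dx dy : Fin k → ZMod m → ℂ)
    (hne : ∀ l j, dx l j ≠ 0 ∨ dy l j ≠ 0)
    (hx : ∀ l, P l → ∀ j, dx l j = dx l 0) (hy : ∀ l, P l → ∀ j, dy l j = dy l 0)
    (hcard : m ≤ Fintype.card {l // P l} + 1) :
    ∃ (u : Fin k → ZMod m → ℂ) (v : Fin (k + 1) → ZMod m → ℂ), (u ≠ 0 ∨ v ≠ 0) ∧
      (∀ i j, (∑ l, inc k ℂ i l * (dx l j * u l j)) +
        (cx i j * v i j - cx i (j + 1) * v i (j + 1)) = 0) ∧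
      (∀ i j, (∑ l, inc k ℂ i l * (dy l j * u l j)) +
        (cy i j * v i j - cy i (j + 1) * v i (j + 1)) = 0) := by
  -- The source in column `l` points in a direction independent of the weight vector `(dx l 0, dy l
  -- 0)`.
  have he : ∀ l, ∃ e : ℂ × ℂ, e.1 * dy l 0 - e.2 * dx l 0 ≠ 0 := by
    intro l
    rcases hne l 0 with h | h
    · exact ⟨(0, 1), by simpa using h⟩
    · exact ⟨(1, 0), by simpa using h⟩
  choose e he using he
  let prj : (((Fin k × ZMod m → ℂ) × (Fin (k + 1) × ZMod m → ℂ)) × ({l // P l} → ℂ) × ℂ × ℂ) →ₗ[ℂ]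
      ((Fin k × ZMod m → ℂ) × (Fin (k + 1) × ZMod m → ℂ)) × ({l // P l} → ℂ) × ℂ :=
    LinearMap.id.prodMap (LinearMap.id.prodMap (LinearMap.fst ℂ ℂ ℂ))
  let prj' : (((Fin k × ZMod m → ℂ) × (Fin (k + 1) × ZMod m → ℂ)) × ({l // P l} → ℂ) × ℂ × ℂ) →ₗ[ℂ]
      ((Fin k × ZMod m → ℂ) × (Fin (k + 1) × ZMod m → ℂ)) × ({l // P l} → ℂ) × ℂ :=
    LinearMap.id.prodMap (LinearMap.id.prodMap (LinearMap.snd ℂ ℂ ℂ))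
  let T := ((cylinderMap P cx dx fun l => (e l).1).comp prj).prod
    ((cylinderMap P cy dy fun l => (e l).2).comp prj')
  -- The `s` sources are shared by both systems, while each has its own `r`; the domain thus exceeds
  -- the codomain in dimension as soon as `m < card + 2`.
  have hker : LinearMap.ker T ≠ ⊥ := by
    apply LinearMap.ker_ne_bot_of_finrank_lt
    simp only [Module.finrank_prod, Module.finrank_fintype_fun_eq_card, Fintype.card_prod,
      Fintype.card_fin, ZMod.card, Module.finrank_self]
    have : (k + 1) * m = k * m + m := by ring
    omega
  obtain ⟨⟨⟨u, v⟩, s, r, r'⟩, hq, hq0⟩ := Submodule.exists_mem_ne_zero_of_ne_bot hker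
  have hT : cylinderMap P cx dx (fun l => (e l).1) ((u, v), s, r) = 0 ∧
      cylinderMap P cy dy (fun l => (e l).2) ((u, v), s, r') = 0 := by
    have h := LinearMap.mem_ker.1 hq
    exact ⟨congrArg Prod.fst h, congrArg Prod.snd h⟩
  obtain ⟨rfl, h1⟩ := sum_cylinderMap P cx dx _ u v s r hT.1
  obtain ⟨rfl, h2⟩ := sum_cylinderMap P cy dy _ u v s r' hT.2
  have hs : s = 0 := by
    funext l
    have h3 := h1 l
    have h4 := h2 l
    simp_rw [hx l l.2] at h3
    simp_rw [hy l l.2] at h4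
    rw [← Finset.mul_sum] at h3 h4
    -- As the column is constant, both sums are multiples of the same sum of `u`, which is
    -- eliminated here.
    have h5 : ((e l).1 * dy l 0 - (e l).2 * dx l 0) * s l = 0 := by
      linear_combination dy l 0 * h3 - dx l 0 * h4
    exact (mul_eq_zero.1 h5).resolve_left (he l)
  subst hs
  refine ⟨fun l j => u (l, j), fun i j => v (i, j), ?_, fun i j => ?_, fun i j => ?_⟩
  · by_contra! hc
    refine hq0 ?_
    have hu : u = 0 := funext fun x => congrFun (congrFun hc.1 x.1) x.2
    have hv : v = 0 := funext fun x => congrFun (congrFun hc.2 x.1) x.2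
    rw [hu, hv]; rfl
  · simpa [cylinderMap] using congrFun hT.1 (i, j)
  · simpa [cylinderMap] using congrFun hT.2 (i, j)

/-- The values of a periodic function at a window of the cylinder. -/
def window (u : Fin k → ZMod m → ℂ) (v : Fin (k + 1) → ZMod m → ℂ) (o : ZMod m) : Face k → ℂ
  | Sum.inl (i, j) => v i (o + (j : ℕ))
  | Sum.inr (i, j) => u i (o + (j : ℕ))

theorem sum_window (c : Fin (k + 1) → ZMod m → ℂ) (d : Fin k → ZMod m → ℂ)
    (u : Fin k → ZMod m → ℂ) (v : Fin (k + 1) → ZMod m → ℂ) (o : ZMod m)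
    (h : ∀ i j, (∑ l, inc k ℂ i l * (d l j * u l j)) +
        (c i j * v i j - c i (j + 1) * v i (j + 1)) = 0) (w : White k) :
    ∑ g, window d c o g * incFace ℂ w g * window u v o g = 0 := by
  rw [← h w.1 (o + (w.2 : ℕ)), Fintype.sum_sum_type, Fintype.sum_prod_type,
    Fintype.sum_prod_type]
  refine (add_comm _ _).trans (congrArg₂ (· + ·) ?_ ?_)
  · refine Finset.sum_congr rfl fun i _ => ?_
    rw [Finset.sum_eq_single w.2 (by intro i _ hi; simp [incFace, Ne.symm hi]) (by simp)]
    simp only [window, incFace, if_true]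
    ring
  · rw [Finset.sum_eq_single w.1 (by intro i _ hi; simp [incFace, Ne.symm hi]) (by simp)]
    simp only [window, incFace, if_true]
    have := sum_inc_mul (fun j => c w.1 (o + (j : ℕ)) * v w.1 (o + (j : ℕ))) w.2
    simp only [Fin.val_castSucc, Fin.val_succ, Nat.cast_add, Nat.cast_one, ← add_assoc] at this
    rw [← this]
    exact Finset.sum_congr rfl fun _ _ => by ring

theorem sum_window_bottom (c : Fin (k + 1) → ZMod m → ℂ) (d : Fin k → ZMod m → ℂ)
    (u : Fin k → ZMod m → ℂ) (v : Fin (k + 1) → ZMod m → ℂ) (o : ZMod m) :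
    ∑ g, window d c o g * bottom ℂ g * window u v o g = ∑ i, c i o * v i o := by
  simp [Fintype.sum_sum_type, Fintype.sum_prod_type, window, bottom]

/-- A conservation law: adding the equations over `i` removes the `inc` terms, since the columns of
`inc` sum to zero. -/
theorem sum_row_eq (c : Fin (k + 1) → ZMod m → ℂ) (d : Fin k → ZMod m → ℂ)
    (u : Fin k → ZMod m → ℂ) (v : Fin (k + 1) → ZMod m → ℂ)
    (h : ∀ i j, (∑ l, inc k ℂ i l * (d l j * u l j)) +
        (c i j * v i j - c i (j + 1) * v i (j + 1)) = 0) (j : ZMod m) :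
    ∑ i, c i (j + 1) * v i (j + 1) = ∑ i, c i j * v i j := by
  have h1 : ∑ i, ((∑ l, inc k ℂ i l * (d l j * u l j)) +
        (c i j * v i j - c i (j + 1) * v i (j + 1))) = 0 := Finset.sum_eq_zero fun i _ => h i j
  rw [Finset.sum_add_distrib, Finset.sum_comm, Finset.sum_sub_distrib] at h1
  simp_rw [← Finset.sum_mul, sum_inc_fst] at h1
  simp only [zero_mul, Finset.sum_const_zero, zero_add] at h1
  exact (sub_eq_zero.1 h1).symm

/-- The `k + 1` rows of even faces cover the cylinder, but the `k` rows of odd faces may miss one.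
Hence only `v = 0` is read off directly; the equations then force `u = 0`. -/
theorem window_ne_zero [NeZero m] (hmk : m ≤ k + 1) (cx cy : Fin (k + 1) → ZMod m → ℂ)
    (dx dy : Fin k → ZMod m → ℂ) (hne : ∀ l j, dx l j ≠ 0 ∨ dy l j ≠ 0)
    (u : Fin k → ZMod m → ℂ) (v : Fin (k + 1) → ZMod m → ℂ) (huv : u ≠ 0 ∨ v ≠ 0)
    (hx : ∀ i j, (∑ l, inc k ℂ i l * (dx l j * u l j)) +
        (cx i j * v i j - cx i (j + 1) * v i (j + 1)) = 0)
    (hy : ∀ i j, (∑ l, inc k ℂ i l * (dy l j * u l j)) +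
        (cy i j * v i j - cy i (j + 1) * v i (j + 1)) = 0) (o : ZMod m) :
    window u v o ≠ 0 := by
  intro h0
  have hv : v = 0 := by
    funext i z
    have hlt : (z - o).val < k + 1 := (ZMod.val_lt _).trans_le hmk
    have := congrFun h0 (Sum.inl (i, ⟨(z - o).val, hlt⟩))
    simpa [window] using this
  subst hv
  have hu : u = 0 := by
    funext l j
    have e1 := congrFun (eq_zero_of_sum_inc_mul (f := fun l => dx l j * u l j)
      (fun i => by simpa using hx i j)) l
    have e2 := congrFun (eq_zero_of_sum_inc_mul (f := fun l => dy l j * u l j)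
      (fun i => by simpa using hy i j)) l
    rcases hne l j with h | h
    · exact (mul_eq_zero.1 e1).resolve_left h
    · exact (mul_eq_zero.1 e2).resolve_left h
  subst hu
  simp at huv

end Periodic

/-! ### Reduction of the weights modulo the period -/

section Weights

theorem coord_ne_zero (z : OnePoint ℂ) : coordX z ≠ 0 ∨ coordY z ≠ 0 := by
  induction z using OnePoint.rec with
  | infty => left; simp [coordX]
  | coe z => right; simp [coordY]

theorem periodic_emod {α : Type*} {f : ℤ → α} {m : ℤ} (h : ∀ n, f n = f (n + m)) (n : ℤ) :
    f (n % m) = f n := by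
  have hp : Function.Periodic f m := fun n => (h n).symm
  rw [Int.emod_def, mul_comm]
  exact hp.sub_int_mul_eq _

theorem two_mul_add_one_emod {m : ℕ} (hm : 0 < m) (n : ℤ) :
    (2 * n + 1) % (2 * (m : ℤ)) = 2 * (n % m) + 1 := by
  have hm' : (0 : ℤ) < m := by exact_mod_cast hm
  have h1 := Int.emod_nonneg n hm'.ne'
  have h2 := Int.emod_lt_of_pos n hm'
  have h3 : 2 * n + 1 = (2 * (n % m) + 1) + 2 * (m : ℤ) * (n / m) := by
    linear_combination (-2 : ℤ) * Int.emod_add_mul_ediv n m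
  rw [h3, Int.add_mul_emod_self_left, Int.emod_eq_of_lt (by omega) (by omega)]

end Weights

end Aztec

open Aztec in
theorem theorem5p7 (m p k : ℕ) (hm : 2 ≤ m) (hp : 1 ≤ p)
    (hk : (k : ℤ) = (m : ℤ) * p - 2 * p + 1)
    (a : ℤ → ℤ → OnePoint ℂ) (ha : Aztec.PeriodicWeights m p k a)
    (φ φ' : Aztec.White k → Aztec.Black k → ℤˣ)
    (hφ : Aztec.IsKasteleyn φ) (hφ' : Aztec.IsKasteleyn φ')
    (hY : Aztec.YDefined k φ (Aztec.faceWeight k a))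
    (hY' : Aztec.YDefined k φ' (Aztec.faceWeight k (Aztec.shiftWeights m a))) :
    Aztec.Y k φ (Aztec.faceWeight k a) =
      Aztec.Y k φ' (Aztec.faceWeight k (Aztec.shiftWeights m a)) := by
  have hm0 : 0 < m := by omega
  have : NeZero m := ⟨hm0.ne'⟩
  obtain ⟨hc, hd, δ, hδ⟩ := ha
  obtain ⟨q, rfl⟩ : ∃ q, m = q + 2 := ⟨m - 2, by omega⟩
  have hk' : k = q * p + 1 := by
    zify; rw [hk]; push_cast; ring
  set m := q + 2 with hmq
  let C : Fin (k + 1) → ZMod m → OnePoint ℂ := fun i z => a (2 * (i : ℕ)) (2 * (z.val : ℤ))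
  let D : Fin k → ZMod m → OnePoint ℂ := fun i z => a (2 * (i : ℕ) + 1) (2 * (z.val : ℤ) + 1)
  have hC : ∀ i (n : ℤ), C i (n : ZMod m) = a (2 * (i : ℕ)) (2 * n) := by
    intro i n
    simp only [C, ZMod.val_intCast]
    exact periodic_emod (f := fun n => a (2 * (i : ℕ)) (2 * n))
      (fun n => hc i n (by positivity) (by have := i.isLt; omega)) n
  have hD : ∀ i (n : ℤ), D i (n : ZMod m) = a (2 * (i : ℕ) + 1) (2 * n + 1) := by
    intro i n
    simp only [D, ZMod.val_intCast]
    exact periodic_emod (f := fun n => a (2 * (i : ℕ) + 1) (2 * n + 1))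
      (fun n => hd i n (by positivity) (by have := i.isLt; omega)) n
  have hconst : ∀ i : Fin k, p ∣ (i : ℕ) → ∀ z, D i z = D i 0 := by
    intro i hi z
    have hi' : (p : ℤ) ∣ ((i : ℕ) : ℤ) := by exact_mod_cast hi
    simp only [D]
    rw [hδ i _ (by positivity) (by have := i.isLt; omega) hi',
      hδ i _ (by positivity) (by have := i.isLt; omega) hi']
  have hcard : m ≤ Fintype.card {i : Fin k // p ∣ (i : ℕ)} + 1 := by
    -- Since `k = q * p + 1`, the multiples `0, p, …, q * p` are all valid columns; these are `q + 1
    -- = m - 1` of them.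
    have : Fintype.card (Fin (q + 1)) ≤ Fintype.card {i : Fin k // p ∣ (i : ℕ)} := by
      refine Fintype.card_le_of_injective (fun l => ⟨⟨l * p, ?_⟩, Dvd.intro_left _ rfl⟩) ?_
      · have := Nat.mul_le_mul_right p (Nat.le_of_lt_succ l.isLt)
        omega
      · intro l l' h
        simp only [Subtype.mk.injEq, Fin.mk.injEq] at h
        exact Fin.ext (Nat.eq_of_mul_eq_mul_right hp h)
    rw [Fintype.card_fin] at this
    omega
  have hmk : m ≤ k + 1 := by
    have := Nat.mul_le_mul_left q hp
    omega
  have hne : ∀ l j, coordX (D l j) ≠ 0 ∨ coordY (D l j) ≠ 0 := fun l j => coord_ne_zero _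
  obtain ⟨u, v, huv, hx, hy⟩ := exists_periodic_kernel (fun i : Fin k => p ∣ (i : ℕ))
    (fun i z => coordX (C i z)) (fun i z => coordY (C i z)) (fun i z => coordX (D i z))
    (fun i z => coordY (D i z)) hne (fun l hl j => by rw [hconst l hl])
    (fun l hl j => by rw [hconst l hl]) hcard
  -- `Y` of the window at offset `o`, in terms of row `o` alone. Offset `0` is the given weight;
  -- offset `1` is the shift, two grid units being one step of the index.
  have key : ∀ (o : ZMod m) (b : Face k → OnePoint ℂ)
      (_ : ∀ i j, b (Sum.inl (i, j)) = C i (o + (j : ℕ)))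
      (_ : ∀ i j, b (Sum.inr (i, j)) = D i (o + (j : ℕ)))
      (φ : White k → Black k → ℤˣ), IsKasteleyn φ → YDefined k φ b →
      Y k φ b = if ∑ i, coordY (C i o) * v i o = 0 then ∞ else
        ((swapSign k * ((∑ i, coordX (C i o) * v i o) / ∑ i, coordY (C i o) * v i o) : ℂ) :
          OnePoint ℂ) := by
    intro o b hb1 hb2 φ hφ hY
    have hbx : (fun g => coordX (b g)) =
        window (fun i z => coordX (D i z)) (fun i z => coordX (C i z)) o := by
      funext g
      rcases g with ⟨i, j⟩ | ⟨i, j⟩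
      · rw [hb1]; rfl
      · rw [hb2]; rfl
    have hby : (fun g => coordY (b g)) =
        window (fun i z => coordY (D i z)) (fun i z => coordY (C i z)) o := by
      funext g
      rcases g with ⟨i, j⟩ | ⟨i, j⟩
      · rw [hb1]; rfl
      · rw [hb2]; rfl
    have hbx' := fun g => congrFun hbx g
    have hby' := fun g => congrFun hby g
    refine Y_eq_of_kernel hφ b hY (window u v o)
      (window_ne_zero hmk _ _ _ _ hne u v huv hx hy o) (fun w => ?_) (fun w => ?_) ?_ ?_
    · simp_rw [hbx']; exact sum_window _ _ u v o hx w
    · simp_rw [hby']; exact sum_window _ _ u v o hy w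
    · simp_rw [hbx']; exact sum_window_bottom _ _ u v o
    · simp_rw [hby']; exact sum_window_bottom _ _ u v o
  have hX := sum_row_eq _ _ u v hx 0
  have hY₀ := sum_row_eq _ _ u v hy 0
  rw [zero_add] at hX hY₀
  rw [key 0 _ (fun i j => ?_) (fun i j => ?_) φ hφ hY,
    key 1 _ (fun i j => ?_) (fun i j => ?_) φ' hφ' hY', hX, hY₀]
  · have := hC i (((j : ℕ) + 1 : ℤ) % m)
    rw [ZMod.intCast_mod] at this
    push_cast at this
    rw [add_comm (1 : ZMod m), this, faceWeight, shiftWeights,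
      ← Int.mul_emod_mul_of_pos _ _ two_pos, mul_add, mul_one]
  · have := hD i (((j : ℕ) + 1 : ℤ) % m)
    rw [ZMod.intCast_mod] at this
    push_cast at this
    rw [add_comm (1 : ZMod m), this, faceWeight, shiftWeights, ← two_mul_add_one_emod hm0,
      show 2 * ((j : ℕ) : ℤ) + 1 + 2 = 2 * ((j : ℕ) + 1) + 1 by ring]
  · have := hC i (j : ℕ)
    rw [zero_add, ← Int.cast_natCast, this]; rfl
  · have := hD i (j : ℕ)
    rw [zero_add, ← Int.cast_natCast, this]; rfl
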